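/- Let $N$ single bosons enter the input ports $1,\dots,N$ of a multiport with $M\ge N$ ports described by a unitary $M\times M$ matrix $U$. For an output configuration $\mathbf m=(m_1,\dots,m_M)$, $m_l\ge 0$, $\sum_l m_l=N$, let $l_1\le\dots\le l_N$ list each port $l$ exactly $m_l$ times, and let $$\hat p_U(\mathbf m)=\frac{|\mathrm{per}\,U[1,\dots,N\,|\,l_1,\dots,l_N]|^2}{m_1!\cdots m_M!}$$ be the probability of detecting $\mathbf m$, where $U[1,\dots,N\,|\,l_1,\dots,l_N]$ has entries $U_{k l_j}$, $1\le k,j\le N$. The modified Glynn algorithm computes $\hat p_U(\mathbf m)$ as follows (for $N=0$ it returns $1$). Let $p$ be an occupied port ($m_p>0$) of minimal occupation, and let $L$ be the set of the other occupied ports. It evaluates $$\mathrm{per}\,U[1,\dots,N\,|\,l_1,\dots,l_N]=\frac{\prod_l m_l!}{\prod_{l\in L}(m_l+1)}\sum_{(x_l)_{l\in L}}\Bigl(\prod_{l\in L}x_l\Bigr)\prod_{k=1}^N\Bigl(U_{kp}+\sum_{l\in L}x_lU_{kl}\Bigr),\qquad x_l^{m_l+1}=1,$$ passing through the values of $(x_l)_{l\in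 L}$ in a Gray-code order that changes one $x_l$ at a time and updates the $N$ inner sums; it then forms $|\mathrm{per}|^2/\prod_l m_l!$. Let $\mathcal C_{\mathbf m}$ be the number of elementary operations on complex numbers (additions, subtractions, multiplications, divisions, conjugations, evaluations of a root of unity $e^{2\pi i/q}$) that it performs. Theorem. The modified Glynn algorithm returns $\hat p_U(\mathbf m)$ for all $N\le M$, $U$ and $\mathbf m$. Moreover, there are absolute constants $c,C>0$ such that for every $\varepsilon>0$ there is $N_0$ such that for all $N\ge N_0$ and all $M\ge N$ the following holds. For $\varepsilon\ge1$ nothing is claimed; otherwise put $$\rho=\frac NM,\qquad \delta=2\sqrt{\frac{1+\rho}{N}\ln\frac2\varepsilon},\qquad r=\max\Bigl(1,\frac{1+\rho}{1+\delta}\Bigr),$$ and consider the bounds $$c\,N\,2^{\frac{1-\delta}{1+\rho}N}\ \le\ \mathcal C_{\mathbf m}\ \le\ C\,N\,(1+r)^{N/r}.\qquad(*)$$ (i) If $U$ is Haar-distributed on the unitary group $U(M)$ and, given $U$, the configuration $\mathbf m$ has the distribution $\hat p_U$, then $(*)$ holds with probability at least $1-\varepsilon$. (ii) With probability at least $1-\varepsilon$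 in the Haar measure over $U\in U(M)$, the multiport $U$ is such that $(*)$ holds with probability at least $1-\varepsilon$ for $\mathbf m$ distributed according to $\hat p_U$. -/

import Mathlib

open scoped Nat

/-! ### Computations with a count of elementary operations -/

/-- A computed value together with the number of elementary operations spent on it. -/
structure Counted (α : Type) where
  val : α
  ops : ℕ

namespace Counted

instance : Monad Counted where
  pure a := ⟨a, 0⟩
  bind x f := ⟨(f x.val).val, x.ops + (f x.val).ops⟩

/-- One addition of complex numbers. -/
noncomputable def add (z w : ℂ) : Counted ℂ := ⟨z + w, 1⟩

/-- One subtraction of complex numbers. -/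
noncomputable def sub (z w : ℂ) : Counted ℂ := ⟨z - w, 1⟩

/-- One multiplication of complex numbers. -/
noncomputable def mul (z w : ℂ) : Counted ℂ := ⟨z * w, 1⟩

/-- One division of complex numbers. -/
noncomputable def div (z w : ℂ) : Counted ℂ := ⟨z / w, 1⟩

/-- One complex conjugation. -/
noncomputable def conj (z : ℂ) : Counted ℂ := ⟨starRingEnd ℂ z, 1⟩

/-- One evaluation of the root of unity `exp (2πi / q)`. -/
noncomputable def rootOfUnity (q : ℕ) : Counted ℂ :=
  ⟨Complex.exp (2 * Real.pi * Complex.I / q), 1⟩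

/-- Compute an array entry by entry; the operations of all entries are added up. -/
def tabulate {N : ℕ} {α : Type} (f : Fin N → Counted α) : Counted (Fin N → α) :=
  ⟨fun k => (f k).val, ∑ k, (f k).ops⟩

/-- `z + z₁ + z₂ + ⋯`, one addition for each entry of the list. -/
noncomputable def addAll (z : ℂ) : List ℂ → Counted ℂ
  | [] => pure z
  | w :: ws => do
      let s ← addAll z ws
      add w s

/-- The product of a list, one multiplication for each entry. -/
noncomputable def prodAll : List ℂ → Counted ℂ
  | [] => pure 1
  | w :: ws => do
      let p ← prodAll ws
      mul w p

/-- Run the same step `t` times in succession. -/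
def iter {α : Type} (step : α → Counted α) : ℕ → α → Counted α
  | 0, s => pure s
  | t + 1, s => do
      let s' ← step s
      iter step t s'

end Counted

/-! ### Single bosons on a unitary multiport -/

/-- Output configurations `m = (m₁, …, m_M)` with `m₁ + ⋯ + m_M = N`. -/
def Config (M N : ℕ) : Type := {m : Fin M → ℕ // ∑ l, m l = N}

instance (M N : ℕ) : Fintype (Config M N) :=
  Fintype.subtype (Finset.piAntidiag Finset.univ N) (by intro m; simp)

/-- The output ports `l₁ ≤ ⋯ ≤ l_N` of a configuration: port `l` is listed `m l` times. -/
def portList {M : ℕ} (m : Fin M → ℕ) : List (Fin M) :=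
  (List.finRange M).flatMap fun l => List.replicate (m l) l

theorem length_portList {M : ℕ} (m : Fin M → ℕ) : (portList m).length = ∑ l, m l := by
  simp [portList, List.length_flatMap, List.sum_ofFn, ← List.ofFn_eq_map]

/-- The `j`-th output port of a configuration. -/
def port {M N : ℕ} (m : Config M N) (j : Fin N) : Fin M :=
  (portList m.1).get (j.cast ((length_portList m.1).trans m.2).symm)

/-- The probability `|per U[1,…,N | l₁,…,l_N]|² / (m₁! ⋯ m_M!)` of the output configuration `m`,
when one boson enters each of the input ports `1, …, N` of the multiport `U`. -/
noncomputable def outputProb {M N : ℕ} (h : N ≤ M) (U : Matrix.unitaryGroup (Fin M) ℂ)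
    (m : Config M N) : ℝ :=
  ‖(Matrix.of fun k j : Fin N => U.1 (Fin.castLE h k) (port m j)).permanent‖ ^ 2 /
    ∏ l, ((m.1 l)! : ℝ)

/-! ### Haar measure on the unitary group -/

noncomputable instance (M : ℕ) : MeasurableSpace (Matrix.unitaryGroup (Fin M) ℂ) := borel _

instance (M : ℕ) : BorelSpace (Matrix.unitaryGroup (Fin M) ℂ) := ⟨rfl⟩

instance (M : ℕ) : CompactSpace (Matrix.unitaryGroup (Fin M) ℂ) := by
  suffices IsCompact (Matrix.unitaryGroup (Fin M) ℂ : Set (Matrix (Fin M) (Fin M) ℂ)) from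
    isCompact_iff_compactSpace.mp this
  refine IsCompact.of_isClosed_subset
    (isCompact_univ_pi fun _ : Fin M => isCompact_univ_pi fun _ : Fin M =>
      isCompact_closedBall (0 : ℂ) 1) ?_ ?_
  · have h : (Matrix.unitaryGroup (Fin M) ℂ : Set (Matrix (Fin M) (Fin M) ℂ)) =
        {A | star A * A = 1} ∩ {A | A * star A = 1} := rfl
    rw [h]
    exact (isClosed_eq (by fun_prop) (by fun_prop)).inter (isClosed_eq (by fun_prop) (by fun_prop))
  · intro A hA i _ j _
    simpa using entry_norm_bound_of_unitary hA i j

/-- The Haar probability measure on the group of unitary `M × M` matrices. -/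
noncomputable def haarUnitary (M : ℕ) :
    MeasureTheory.Measure (Matrix.unitaryGroup (Fin M) ℂ) :=
  MeasureTheory.Measure.haarMeasure ⊤

instance (M : ℕ) : MeasureTheory.IsProbabilityMeasure (haarUnitary M) :=
  ⟨by
    simpa [haarUnitary] using MeasureTheory.Measure.haarMeasure_self
      (K₀ := (⊤ : TopologicalSpace.PositiveCompacts (Matrix.unitaryGroup (Fin M) ℂ)))⟩

/-! ### The modified Glynn algorithm -/

/-- The memory of the algorithm: the current values of the variables `x_l`, the product of those
that are summed over, the `N` inner sums `∑_l x_l A_{kl}`, and the outer sum so far. -/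
structure GlynnState (M N : ℕ) where
  x : Fin M → ℂ
  phase : ℂ
  sums : Fin N → ℂ
  acc : ℂ

section Glynn

variable {M N : ℕ}

/-- Replace `x_l` by `w * x_l` and update the phase and the inner sums accordingly. -/
noncomputable def glynnRotate (A : Matrix (Fin N) (Fin M) ℂ) (l : Fin M) (w : ℂ)
    (s : GlynnState M N) : Counted (GlynnState M N) := do
  let x' ← Counted.mul w (s.x l)
  let d ← Counted.sub x' (s.x l)
  let sums' ← Counted.tabulate fun k => do
    let t ← Counted.mul d (A k l)
    Counted.add (s.sums k) t
  let phase' ← Counted.mul w s.phase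
  pure ⟨Function.update s.x l x', phase', sums', s.acc⟩

/-- Add the term of the current `x` to the outer sum. -/
noncomputable def glynnTerm (s : GlynnState M N) : Counted (GlynnState M N) := do
  let p ← Counted.prodAll (List.ofFn s.sums)
  let t ← Counted.mul s.phase p
  let a ← Counted.add s.acc t
  pure ⟨s.x, s.phase, s.sums, a⟩

/-- Run through all values of the variables `x_l`, for `l` in the given list, changing one variable
at a time (a Gray code): `x_l` takes `m l + 1` values, from each to the next by the factor `w l`. -/
noncomputable def glynnLoop (A : Matrix (Fin N) (Fin M) ℂ) (m : Fin M → ℕ) (w : Fin M → ℂ) :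
    List (Fin M) → GlynnState M N → Counted (GlynnState M N)
  | [] => glynnTerm
  | l :: ls => fun s => do
      let s₀ ← glynnLoop A m w ls s
      Counted.iter (fun s' => do
        let s'' ← glynnRotate A l (w l) s'
        glynnLoop A m w ls s'') (m l) s₀

/-- The table of the roots of unity `exp (2πi / (m l + 1))`, for `l` in the given list. -/
noncomputable def glynnRoots (m : Fin M → ℕ) : List (Fin M) → Counted (Fin M → ℂ)
  | [] => pure fun _ => 1
  | l :: ls => do
      let w ← glynnRoots m ls
      let z ← Counted.rootOfUnity (m l + 1)
      pure (Function.update w l z)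

/-- The occupied output ports. -/
def occupied (m : Fin M → ℕ) : List (Fin M) :=
  (List.finRange M).filter fun l => 0 < m l

/-- The modified Glynn algorithm for the probability of the configuration `m`, where the rows of `A`
are the rows of the multiport that belong to the input ports. With `p` an occupied port of
minimal occupation and `l` running over the other occupied ports, it computes
`per = (∏ m_l!) / ∏_{l ≠ p} (m_l + 1) * ∑_x (∏_{l ≠ p} x_l) ∏_k (∑_{l ≠ p} x_l A_{kl} + A_{kp})`,
where `x_l` runs over the `(m_l + 1)`-th roots of unity, and then `|per|² / ∏ m_l!`. -/
noncomputable def modifiedGlynn (A : Matrix (Fin N) (Fin M) ℂ) (m : Fin M → ℕ) : Counted ℂ :=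
  match (occupied m).argmin m with
  | none => pure 1
  | some p => do
      let others := (occupied m).erase p
      let w ← glynnRoots m others
      let sums ← Counted.tabulate fun k => Counted.addAll (A k p) (others.map (A k))
      let s ← glynnLoop A m w others ⟨fun _ => 1, 1, sums, 0⟩
      let d ← Counted.prodAll (others.map fun l => ((m l + 1 : ℕ) : ℂ))
      let q ← Counted.div s.acc d
      let f ← Counted.prodAll
        ((occupied m).flatMap fun l => (List.range (m l)).map fun j => ((j + 1 : ℕ) : ℂ))
      let per ← Counted.mul f q
      let per' ← Counted.conj per
      let sq ← Counted.mul per per'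
      Counted.div sq f

end Glynn

/-- The modified Glynn algorithm for an output probability of `N` single bosons that enter the input
ports `1, …, N` of the multiport `U`. -/
noncomputable def glynnProb {M N : ℕ} (h : N ≤ M) (U : Matrix.unitaryGroup (Fin M) ℂ)
    (m : Config M N) : Counted ℂ :=
  modifiedGlynn (Matrix.of fun (k : Fin N) (l : Fin M) => U.1 (Fin.castLE h k) l) m.1

/-! ### The bounds -/

/-- The density of bosons `ρ = N / M`. -/
noncomputable def density (M N : ℕ) : ℝ := N / M

/-- `δ = 2 √((1 + ρ) / N * ln (2 / ε))`. -/
noncomputable def deviation (M N : ℕ) (ε : ℝ) : ℝ :=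
  2 * √((1 + density M N) / N * Real.log (2 / ε))

/-- `r = max (1, (1 + ρ) / (1 + δ))`. -/
noncomputable def rate (M N : ℕ) (ε : ℝ) : ℝ :=
  max 1 ((1 + density M N) / (1 + deviation M N ε))

/-- The number of operations spent by the modified Glynn algorithm on the probability of the
configuration `m` lies between `c N 2^((1-δ)N/(1+ρ))` and `C N (1+r)^(N/r)`. -/
def WithinBounds (c C ε : ℝ) {M N : ℕ} (h : N ≤ M) (U : Matrix.unitaryGroup (Fin M) ℂ)
    (m : Config M N) : Prop :=
  c * (N * (2 : ℝ) ^ ((1 - deviation M N ε) * N / (1 + density M N))) ≤ (glynnProb h U m).ops ∧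
  ((glynnProb h U m).ops : ℝ) ≤ C * (N * (1 + rate M N ε) ^ (N / rate M N ε))

open Classical in
/-- The probability, under the output distribution of the multiport `U`, that the detected
configuration is one for which the number of operations is within the bounds. -/
noncomputable def probWithinBounds (c C ε : ℝ) {M N : ℕ} (h : N ≤ M)
    (U : Matrix.unitaryGroup (Fin M) ℂ) : ℝ :=
  ∑ m : Config M N, if WithinBounds c C ε h U m then outputProb h U m else 0

/-!
Why the theorem holds.

*Correctness.* The permanent belonging to a configuration `m` is `∏ m_l!` times the coefficient
`amplitude A m` of `z ^ m` in the product of linear forms `∏_k ∑_l A_{kl} z_l` (`permanent_port`,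
`prod_sum_eq_sum_amplitude`). The sum over the roots of unity picks from this product the
configurations `m'` with `m_l + 1 ∣ m'_l + 1` for all occupied ports `l ≠ p`, and by the minimality
of `m_p` the only one is `m` itself (`config_eq_of_dvd`, `torusSum_glynnSummand`). The Gray-code loop
computes this sum although it never resets a variable, because the sum depends on its starting point
only through the orbit under multiplication by the roots of unity (`val_glynnLoop`).

*Cost.* The number of operations is of the order of `N` times the number `∏_{l ≠ p} (m_l + 1)` of
summands (`ops_modifiedGlynn`). If `n` ports are occupied, this number is at least `2 ^ (n - 1)`, and
it is at most `(1 + r) ^ (N / r)` as soon as `n ≤ N / r` (`numTerms_occupied_le`). So the bounds hold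
unless `n` is far from `N / (1 + ρ)` (`withinBounds_of_numOccupied`).

*Average over the multiports.* Averaged over the Haar measure, all configurations are equally
probable (`integral_outputProb`): by right invariance the mean square of `∏_k ∑_l U_{kl} z_l` has no
cross terms in the amplitudes and depends only on `∑_l |z_l|²`, hence it is a multiple of
`(∑_l |z_l|²) ^ N`, and comparison with the multinomial theorem gives the mean squares of the
amplitudes. For a uniformly distributed configuration, `n` has a hypergeometric distribution
(`card_numOccupied`), whose factorial moments are bounded by binomial ones, so that Hoeffding's
inequality holds (`hypergeometric_tail_le`). The deviation `δ` is large enough for the bounds to fail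
with probability at most `ε ^ 2` (`card_not_withinBounds_le`); this gives the first claim, and the
second one by Markov's inequality.
-/

/-! ### Assignments of bosons to output ports -/

/-- The configuration reached when the `k`-th boson leaves through the port `f k`: the occupation
of a port is the size of its fibre under `f`. -/
def configOf {M N : ℕ} (f : Fin N → Fin M) : Config M N :=
  ⟨fun l => Fintype.card {k // f k = l}, by
    simpa using (Fintype.card_congr (Equiv.sigmaFiberEquiv f))⟩

noncomputable instance (M N : ℕ) : DecidableEq (Config M N) := Classical.decEq _

theorem prod_comp_eq_prod_pow_configOf {M N : ℕ} {R : Type*} [CommMonoid R] (f : Fin N → Fin M)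
    (z : Fin M → R) : ∏ k, z (f k) = ∏ l, z l ^ (configOf f).1 l := by
  rw [← Finset.prod_fiberwise Finset.univ f (fun k => z (f k))]
  refine Finset.prod_congr rfl fun l _ => ?_
  rw [Finset.prod_congr rfl (g := fun _ => z l) (fun k hk => by simp at hk; rw [hk]),
    Finset.prod_const]
  simp [configOf, Fintype.card_subtype]

theorem count_portList {M : ℕ} (m : Fin M → ℕ) (l : Fin M) : (portList m).count l = m l := by
  rw [portList, List.count_flatMap]
  simp only [Function.comp_def, List.count_replicate]
  rw [← List.ofFn_eq_map, List.sum_ofFn]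
  simp

theorem configOf_port {M N : ℕ} (m : Config M N) : configOf (port m) = m := by
  apply Subtype.ext
  funext l
  change Fintype.card {k // port m k = l} = m.1 l
  rw [← count_portList m.1 l, Fintype.card_subtype]
  have h : (Finset.univ.val.map (port m) : Multiset (Fin M)) = (portList m.1 : List (Fin M)) := by
    have hN : (portList m.1).length = N := (length_portList m.1).trans m.2
    rw [Fin.univ_val_map, Multiset.coe_eq_coe]
    apply List.Perm.of_eq
    apply List.ext_get
    · simp [hN]
    · intro n h1 h2
      simp [port]
  rw [← Multiset.coe_count, ← h, Multiset.count_map, Finset.card_def, Finset.filter_val]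
  congr 2
  funext k
  simp [eq_comm]

/-- Two maps with fibres of the same sizes differ by a permutation of the source, and the
permutations taking one to the other form a coset of the stabilizer. -/
theorem card_perm_comp_eq {α β : Type*} [Fintype α] [DecidableEq α] [Fintype β] [DecidableEq β]
    (g f : α → β)
    (h : ∀ b, Fintype.card {a // f a = b} = Fintype.card {a // g a = b}) :
    Fintype.card {σ : Equiv.Perm α // g ∘ σ = f} = ∏ b, (Fintype.card {a // g a = b})! := by
  rw [← DomMulAct.stabilizer_card g]
  let e (b : β) : {a // f a = b} ≃ {a // g a = b} := Fintype.equivOfCardEq (h b)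
  let s : Equiv.Perm α :=
    (Equiv.sigmaFiberEquiv f).symm.trans
      ((Equiv.sigmaCongrRight e).trans (Equiv.sigmaFiberEquiv g))
  have hs : g ∘ s = f := by
    funext a
    exact (e (f a) ⟨a, rfl⟩).2
  refine Fintype.card_congr ((Equiv.mulRight s⁻¹).subtypeEquiv fun σ => ?_)
  constructor
  · intro hσ
    funext a
    have := congrFun (hσ.trans hs.symm) (s⁻¹ a)
    simpa using this
  · intro hσ
    funext a
    have h1 : g (σ a) = g (s a) := by simpa using congrFun hσ (s a)
    rw [Function.comp_apply, h1, ← hs, Function.comp_apply]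

/-- Reordering the bosons of an assignment reaches every assignment with the same occupations
equally often. -/
theorem sum_perm_comp {M N : ℕ} {R : Type*} [CommSemiring R] (g : Fin N → Fin M)
    (G : (Fin N → Fin M) → R) :
    ∑ σ : Equiv.Perm (Fin N), G (g ∘ σ) =
      (∏ l, (((configOf g).1 l)! : R)) * ∑ f with configOf f = configOf g, G f := by
  rw [← Finset.sum_fiberwise Finset.univ (fun σ : Equiv.Perm (Fin N) => g ∘ σ),
    Finset.mul_sum, Finset.sum_filter]
  refine Finset.sum_congr rfl fun f _ => ?_
  rw [Finset.sum_congr rfl (g := fun _ => G f) (fun σ hσ => by simp at hσ; rw [hσ]),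
    Finset.sum_const, nsmul_eq_mul]
  split_ifs with hf
  · rw [← Fintype.card_subtype, card_perm_comp_eq, Nat.cast_prod]
    · rfl
    · exact fun b => congrFun (congrArg Subtype.val hf) b
  · rw [Finset.card_eq_zero.mpr, Nat.cast_zero, zero_mul]
    refine Finset.filter_eq_empty_iff.mpr fun σ _ hσ => hf ?_
    rw [← hσ]
    apply Subtype.ext
    funext l
    exact Fintype.card_congr
      (σ.symm.subtypeEquiv (p := fun k => g k = l) (q := fun k => (g ∘ σ) k = l)
        fun a => by simp) |>.symm

theorem sum_perm_port {M N : ℕ} {R : Type*} [CommSemiring R] (m : Config M N)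
    (G : (Fin N → Fin M) → R) :
    ∑ σ : Equiv.Perm (Fin N), G (port m ∘ σ) =
      (∏ l, ((m.1 l)! : R)) * ∑ f with configOf f = m, G f := by
  rw [sum_perm_comp, configOf_port]

theorem card_assignments_mul {M N : ℕ} (m : Config M N) :
    (∏ l, (m.1 l)!) * (Finset.univ.filter fun f : Fin N → Fin M => configOf f = m).card = N ! := by
  have := sum_perm_port (R := ℕ) m (fun _ => 1)
  simpa [Fintype.card_perm] using this.symm

/-- The transition amplitude to a configuration, up to the square root of the factorials: the sum,
over all ways in which the `N` bosons reach it, of the products of matrix entries. -/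
noncomputable def amplitude {M N : ℕ} (A : Matrix (Fin N) (Fin M) ℂ) (m : Config M N) : ℂ :=
  ∑ f with configOf f = m, ∏ k, A k (f k)

theorem permanent_port {M N : ℕ} (A : Matrix (Fin N) (Fin M) ℂ) (m : Config M N) :
    (Matrix.of fun k j : Fin N => A k (port m j)).permanent =
      (∏ l, ((m.1 l)! : ℂ)) * amplitude A m := by
  rw [amplitude, ← sum_perm_port m fun f => ∏ k, A k (f k), Matrix.permanent,
    ← Equiv.sum_comp (Equiv.inv (Equiv.Perm (Fin N)))]
  refine Finset.sum_congr rfl fun σ _ => ?_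
  rw [← Equiv.prod_comp σ]
  simp

theorem prod_sum_eq_sum_amplitude {M N : ℕ} (A : Matrix (Fin N) (Fin M) ℂ) (z : Fin M → ℂ) :
    ∏ k, ∑ l, A k l * z l = ∑ m : Config M N, amplitude A m * ∏ l, z l ^ m.1 l := by
  rw [Finset.prod_univ_sum, Fintype.piFinset_univ, ← Finset.sum_fiberwise Finset.univ configOf]
  refine Finset.sum_congr rfl fun m _ => ?_
  rw [amplitude, Finset.sum_mul]
  refine Finset.sum_congr rfl fun f hf => ?_
  simp only [Finset.mem_filter, Finset.mem_univ, true_and] at hf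
  rw [Finset.prod_mul_distrib, prod_comp_eq_prod_pow_configOf f z, hf]

/-- The rows of a multiport that belong to the input ports. -/
noncomputable def inputRows {M N : ℕ} (h : N ≤ M) (U : Matrix.unitaryGroup (Fin M) ℂ) :
    Matrix (Fin N) (Fin M) ℂ :=
  Matrix.of fun k l => U.1 (Fin.castLE h k) l

theorem outputProb_eq {M N : ℕ} (h : N ≤ M) (U : Matrix.unitaryGroup (Fin M) ℂ)
    (m : Config M N) :
    outputProb h U m = (∏ l, ((m.1 l)! : ℝ)) * ‖amplitude (inputRows h U) m‖ ^ 2 := by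
  have hp := permanent_port (inputRows h U) m
  simp only [inputRows, Matrix.of_apply] at hp
  rw [outputProb, hp, norm_mul, norm_prod]
  simp only [Complex.norm_natCast]
  have h0 : (∏ l, ((m.1 l)! : ℝ)) ≠ 0 := Finset.prod_ne_zero_iff.mpr fun l _ => by positivity
  field_simp
  rfl

/-! ### Values and costs of counted computations -/

namespace Counted

@[simp] theorem val_pure {α : Type} (a : α) : (pure a : Counted α).val = a := rfl

@[simp] theorem ops_pure {α : Type} (a : α) : (pure a : Counted α).ops = 0 := rfl

@[simp] theorem val_bind {α β : Type} (x : Counted α) (f : α → Counted β) :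
    (x >>= f).val = (f x.val).val := rfl

@[simp] theorem ops_bind {α β : Type} (x : Counted α) (f : α → Counted β) :
    (x >>= f).ops = x.ops + (f x.val).ops := rfl

theorem val_addAll (z : ℂ) (L : List ℂ) : (addAll z L).val = z + L.sum := by
  induction L with
  | nil => simp [addAll]
  | cons w L ih => simp [addAll, add, ih]; ring

theorem ops_addAll (z : ℂ) (L : List ℂ) : (addAll z L).ops = L.length := by
  induction L with
  | nil => simp [addAll]
  | cons w L ih => simp [addAll, add, ih]

theorem val_prodAll (L : List ℂ) : (prodAll L).val = L.prod := by
  induction L with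
  | nil => simp [prodAll]
  | cons w L ih => simp [prodAll, mul, ih]

theorem ops_prodAll (L : List ℂ) : (prodAll L).ops = L.length := by
  induction L with
  | nil => simp [prodAll]
  | cons w L ih => simp [prodAll, mul, ih]

theorem ops_iter {α : Type} (step : α → Counted α) (c : ℕ) (hc : ∀ s, (step s).ops = c)
    (t : ℕ) (s : α) : (iter step t s).ops = t * c := by
  induction t generalizing s with
  | zero => simp [iter]
  | succ t ih => simp [iter, ih, hc]; ring

/-- A family of values that the step runs through is run through by the iteration. -/
theorem val_iter {α : Type} (step : α → Counted α) (P : ℕ → α → Prop)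
    (hstep : ∀ t s, P t s → P (t + 1) (step s).val) (t n : ℕ) (s : α) (hs : P n s) :
    P (n + t) (iter step t s).val := by
  induction t generalizing s n with
  | zero => exact hs
  | succ t ih =>
    have := ih (n + 1) (step s).val (hstep n s hs)
    rw [add_right_comm] at this
    exact this

end Counted

/-! ### The sum over the roots of unity -/

section Glynn

variable {M N : ℕ}

/-- The sum of `g` over the points obtained from `x` by multiplying each `x_l`, for `l` in the
list, by the powers `w_l ^ 0, …, w_l ^ (m_l)`. -/
noncomputable def torusSum (m : Fin M → ℕ) (w : Fin M → ℂ) (g : (Fin M → ℂ) → ℂ) :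
    List (Fin M) → (Fin M → ℂ) → ℂ
  | [] => g
  | l :: ls => fun x =>
      ∑ j ∈ Finset.range (m l + 1), torusSum m w g ls (Function.update x l (w l ^ j * x l))

theorem sum_range_shift_of_periodic {R : Type*} [AddCommMonoid R] (q : ℕ) (u : ℕ → R)
    (hu : ∀ j, u (j + q) = u j) (e : ℕ) :
    ∑ j ∈ Finset.range q, u (j + e) = ∑ j ∈ Finset.range q, u j := by
  induction e with
  | zero => rfl
  | succ e ih =>
    rw [← ih]
    rcases q with _ | q
    · simp
    · rw [Finset.sum_range_succ, Finset.sum_range_succ' (fun j => u (j + e))]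
      congr 1
      · exact Finset.sum_congr rfl fun j _ => by congr 1; ring
      · rw [← hu (0 + e)]; congr 1; ring

theorem torusSum_rotate (m : Fin M → ℕ) (w : Fin M → ℂ) (g : (Fin M → ℂ) → ℂ)
    (ls : List (Fin M)) (hw : ∀ l ∈ ls, w l ^ (m l + 1) = 1) (e : Fin M → ℕ)
    (he : ∀ l, l ∉ ls → e l = 0) (x : Fin M → ℂ) :
    torusSum m w g ls (fun i => w i ^ e i * x i) = torusSum m w g ls x := by
  induction ls generalizing e x with
  | nil =>
    have : e = 0 := funext fun l => he l (by simp)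
    simp [this]
  | cons l ls ih =>
    simp only [torusSum]
    have hl : w l ^ (m l + 1) = 1 := hw l (by simp)
    rw [← sum_range_shift_of_periodic (m l + 1) (fun j => torusSum m w g ls
      (Function.update x l (w l ^ j * x l))) (fun j => by simp only [pow_add, hl, mul_one]) (e l)]
    refine Finset.sum_congr rfl fun j _ => ?_
    rw [← ih (fun i hi => hw i (by simp [hi])) (Function.update e l 0) ?_
      (Function.update x l (w l ^ (j + e l) * x l))]
    · congr 1
      funext i
      by_cases hi : i = l
      · subst hi; simp [pow_add, mul_assoc]
      · simp [Function.update_of_ne hi]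
    · intro i hi
      by_cases h : i = l
      · subst h; simp
      · rw [Function.update_of_ne h]; exact he i (by simp [h, hi])

theorem torusSum_sum {ι : Type*} (m : Fin M → ℕ) (w : Fin M → ℂ) (s : Finset ι) (c : ι → ℂ)
    (h : ι → (Fin M → ℂ) → ℂ) (ls : List (Fin M)) (x : Fin M → ℂ) :
    torusSum m w (fun x => ∑ i ∈ s, c i * h i x) ls x =
      ∑ i ∈ s, c i * torusSum m w (h i) ls x := by
  induction ls generalizing x with
  | nil => rfl
  | cons l ls ih =>
    simp only [torusSum, ih, Finset.mul_sum]
    exact Finset.sum_comm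

theorem torusSum_monomial (m : Fin M → ℕ) (w : Fin M → ℂ) (S : Finset (Fin M)) (a : Fin M → ℕ)
    (ls : List (Fin M)) (hls : ∀ l ∈ ls, l ∈ S) (x : Fin M → ℂ) :
    torusSum m w (fun x => ∏ l ∈ S, x l ^ a l) ls x =
      (ls.map fun l => ∑ j ∈ Finset.range (m l + 1), (w l ^ a l) ^ j).prod *
        ∏ l ∈ S, x l ^ a l := by
  induction ls generalizing x with
  | nil => simp [torusSum]
  | cons l ls ih =>
    have hl : l ∈ S := hls l (by simp)
    simp only [torusSum, ih fun i hi => hls i (by simp [hi]), List.map_cons, List.prod_cons]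
    rw [Finset.sum_mul, Finset.sum_mul]
    refine Finset.sum_congr rfl fun j _ => ?_
    have : ∏ i ∈ S, Function.update x l (w l ^ j * x l) i ^ a i =
        (w l ^ a l) ^ j * ∏ i ∈ S, x i ^ a i := by
      rw [← Finset.mul_prod_erase S _ hl, ← Finset.mul_prod_erase S (fun i => x i ^ a i) hl,
        Finset.prod_congr rfl (g := fun i => x i ^ a i)
          (fun i hi => by rw [Function.update_of_ne (Finset.ne_of_mem_erase hi)])]
      simp only [Function.update_self]
      ring
    rw [this]
    ring

/-! ### Correctness of the loop -/

/-- The memory contents that belong to the values `x` of the variables in `S`. -/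
noncomputable def consistentState (A : Matrix (Fin N) (Fin M) ℂ) (p : Fin M) (S : Finset (Fin M))
    (x : Fin M → ℂ) (a : ℂ) : GlynnState M N :=
  ⟨x, ∏ l ∈ S, x l, fun k => A k p + ∑ l ∈ S, x l * A k l, a⟩

/-- The summand of the outer sum. -/
noncomputable def glynnSummand (A : Matrix (Fin N) (Fin M) ℂ) (p : Fin M) (S : Finset (Fin M))
    (x : Fin M → ℂ) : ℂ :=
  (∏ l ∈ S, x l) * ∏ k, (A k p + ∑ l ∈ S, x l * A k l)

theorem val_glynnRotate (A : Matrix (Fin N) (Fin M) ℂ) (p : Fin M) (S : Finset (Fin M))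
    (l : Fin M) (hl : l ∈ S) (w : ℂ) (x : Fin M → ℂ) (a : ℂ) :
    (glynnRotate A l w (consistentState A p S x a)).val =
      consistentState A p S (Function.update x l (w * x l)) a := by
  simp only [glynnRotate, consistentState, Counted.val_bind, Counted.val_pure, Counted.mul,
    Counted.sub, Counted.add, Counted.tabulate, GlynnState.mk.injEq, true_and, and_true]
  constructor
  · rw [Finset.prod_update_of_mem hl, ← Finset.mul_prod_erase S x hl,
      Finset.sdiff_singleton_eq_erase]
    ring
  · funext k
    rw [← Finset.add_sum_erase S _ hl,
      ← Finset.add_sum_erase S (fun i => Function.update x l (w * x l) i * A k i) hl,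
      Finset.sum_congr rfl (g := fun i => x i * A k i) (s₁ := S.erase l)
        (f := fun i => Function.update x l (w * x l) i * A k i)
        (fun i hi => by rw [Function.update_of_ne (Finset.ne_of_mem_erase hi)])]
    simp only [Function.update_self]
    ring

theorem val_glynnTerm (A : Matrix (Fin N) (Fin M) ℂ) (p : Fin M) (S : Finset (Fin M))
    (x : Fin M → ℂ) (a : ℂ) :
    (glynnTerm (consistentState A p S x a)).val =
      consistentState A p S x (a + glynnSummand A p S x) := by
  simp [glynnTerm, consistentState, glynnSummand, Counted.mul, Counted.add, Counted.val_prodAll,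
    List.prod_ofFn]

/-- The loop adds the sum over the roots of unity to the accumulator. It does not return to its
starting point, but it ends at a point of the same orbit, which gives the same sum. -/
theorem val_glynnLoop (A : Matrix (Fin N) (Fin M) ℂ) (m : Fin M → ℕ) (w : Fin M → ℂ)
    (p : Fin M) (S : Finset (Fin M)) (ls : List (Fin M)) (hS : ∀ l ∈ ls, l ∈ S)
    (hnd : ls.Nodup) (hw : ∀ l ∈ ls, w l ^ (m l + 1) = 1) (x : Fin M → ℂ) (a : ℂ) :
    ∃ e : Fin M → ℕ, (∀ l, l ∉ ls → e l = 0) ∧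
      (glynnLoop A m w ls (consistentState A p S x a)).val =
        consistentState A p S (fun i => w i ^ e i * x i)
          (a + torusSum m w (glynnSummand A p S) ls x) := by
  induction ls generalizing x a with
  | nil => exact ⟨0, by simp, by simpa [glynnLoop, torusSum] using val_glynnTerm A p S x a⟩
  | cons l ls ih =>
    have hl : l ∉ ls := (List.nodup_cons.mp hnd).1
    have hwl : ∀ i ∈ ls, w i ^ (m i + 1) = 1 := fun i hi => hw i (by simp [hi])
    have ih' := fun y b => ih (fun i hi => hS i (by simp [hi])) (List.nodup_cons.mp hnd).2 hwl y b
    let g := glynnSummand A p S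
    -- After `t` rounds of the iteration `x_l` has been multiplied by `w_l ^ t`.
    let P : ℕ → GlynnState M N → Prop := fun t s => ∃ e : Fin M → ℕ,
      (∀ i, i ∉ l :: ls → e i = 0) ∧ e l = t ∧
      s = consistentState A p S (fun i => w i ^ e i * x i)
        (a + ∑ j ∈ Finset.range (t + 1), torusSum m w g ls (Function.update x l (w l ^ j * x l)))
    have h0 : P 0 (glynnLoop A m w ls (consistentState A p S x a)).val := by
      obtain ⟨e, he, hv⟩ := ih' x a
      exact ⟨e, fun i hi => he i (by simp at hi; exact hi.2), he l hl, by rw [hv]; simp [g]⟩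
    have hstep : ∀ t s, P t s → P (t + 1)
        (glynnRotate A l (w l) s >>= fun s'' => glynnLoop A m w ls s'').val := by
      rintro t s ⟨e, he, hel, rfl⟩
      rw [Counted.val_bind, val_glynnRotate _ _ _ _ (hS l (by simp))]
      obtain ⟨e', he', hv⟩ := ih' (Function.update (fun i => w i ^ e i * x i) l
        (w l * (w l ^ e l * x l))) (a + ∑ j ∈ Finset.range (t + 1),
          torusSum m w g ls (Function.update x l (w l ^ j * x l)))
      have hrot : Function.update (fun i => w i ^ e i * x i) l (w l * (w l ^ e l * x l)) =
          fun i => w i ^ (Function.update e l 0 i) *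
            Function.update x l (w l ^ (t + 1) * x l) i := by
        funext i
        by_cases hi : i = l
        · subst hi; simp [hel, pow_succ]; ring
        · simp [Function.update_of_ne hi]
      refine ⟨fun i => e' i + Function.update e l (t + 1) i, ?_, by simp [he' l hl], ?_⟩
      · intro i hi
        simp only [List.mem_cons, not_or] at hi
        simp only [Function.update_of_ne hi.1, he' i hi.2, he i (by simp [hi])]
      · rw [hv]
        congr 1
        · funext i
          by_cases hi : i = l
          · subst hi; simp [hel, pow_succ, pow_add]; ring
          · simp [Function.update_of_ne hi, pow_add]; ring
        · rw [Finset.sum_range_succ _ (t + 1), add_assoc]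
          congr 2
          rw [hrot, torusSum_rotate m w _ ls hwl]
          intro i hi
          by_cases h : i = l
          · subst h; simp
          · rw [Function.update_of_ne h]; exact he i (by simp [h, hi])
    obtain ⟨e, he, -, hv⟩ := Counted.val_iter _ P hstep (m l) 0 _ h0
    refine ⟨e, he, ?_⟩
    rw [zero_add] at hv
    exact hv

theorem glynnRoots_val (m : Fin M → ℕ) (ls : List (Fin M)) (l : Fin M) (hl : l ∈ ls) :
    (glynnRoots m ls).val l = Complex.exp (2 * Real.pi * Complex.I / (m l + 1 : ℕ)) := by
  induction ls with
  | nil => simp at hl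
  | cons i ls ih =>
    simp only [glynnRoots, Counted.val_bind, Counted.val_pure, Counted.rootOfUnity]
    by_cases h : l = i
    · subst h; simp
    · rw [Function.update_of_ne h]
      exact ih (by simpa [h] using hl)

/-- Only one configuration `m'` passes the divisibility conditions of the sum over the roots of
unity: an occupation `m'_l` other than `m_l` would exceed `m_l` by more than the minimal
occupation `m_p`, which is all that the port `p` can give away. -/
theorem config_eq_of_dvd (m m' : Config M N) (p : Fin M) (S : Finset (Fin M)) (hp : p ∉ S)
    (hm : ∀ l, l ∉ insert p S → m.1 l = 0) (hm' : ∀ l, l ∉ insert p S → m'.1 l = 0)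
    (hmin : ∀ l ∈ S, m.1 p ≤ m.1 l) (hd : ∀ l ∈ S, m.1 l + 1 ∣ m'.1 l + 1) : m' = m := by
  have hs : ∀ c : Config M N, (∀ l, l ∉ insert p S → c.1 l = 0) →
      c.1 p + ∑ l ∈ S, c.1 l = N := by
    intro c hc
    rw [← Finset.sum_insert hp]
    exact (Finset.sum_subset (Finset.subset_univ _) fun l _ hl => hc l hl).trans c.2
  have h1 := hs m hm
  have h2 := hs m' hm'
  have hle : ∀ l ∈ S, m.1 l ≤ m'.1 l := fun l hl => by
    have := Nat.le_of_dvd (by omega) (hd l hl); omega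
  have heq : ∀ l ∈ S, m'.1 l = m.1 l := by
    by_contra! hne
    obtain ⟨i, hi, hne⟩ := hne
    have hbig : m.1 i + m.1 i + 1 ≤ m'.1 i := by
      obtain ⟨q, hq⟩ := hd i hi
      rcases q with _ | _ | q
      · omega
      · omega
      · nlinarith
    have := hmin i hi
    have h3 := Finset.add_sum_erase S m.1 hi
    have h4 := Finset.add_sum_erase S m'.1 hi
    have h5 : ∑ l ∈ S.erase i, m.1 l ≤ ∑ l ∈ S.erase i, m'.1 l :=
      Finset.sum_le_sum fun l hl => hle l (Finset.mem_of_mem_erase hl)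
    omega
  have hpe : m'.1 p = m.1 p := by
    have h3 : ∑ l ∈ S, m'.1 l = ∑ l ∈ S, m.1 l := Finset.sum_congr rfl heq
    omega
  apply Subtype.ext
  funext l
  by_cases hl : l ∈ insert p S
  · rcases Finset.mem_insert.mp hl with rfl | hl
    · exact hpe
    · exact heq l hl
  · rw [hm l hl, hm' l hl]

theorem sum_pow_rootOfUnity (q a : ℕ) (hq : q ≠ 0) :
    ∑ j ∈ Finset.range q, (Complex.exp (2 * Real.pi * Complex.I / q) ^ a) ^ j =
      if q ∣ a then (q : ℂ) else 0 := by
  have hζ := Complex.isPrimitiveRoot_exp q hq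
  split_ifs with h
  · rw [(hζ.pow_eq_one_iff_dvd a).mpr h]
    simp
  · have h1 : Complex.exp (2 * Real.pi * Complex.I / q) ^ a ≠ 1 := fun h' =>
      h ((hζ.pow_eq_one_iff_dvd a).mp h')
    rw [geom_sum_eq h1, ← pow_mul, mul_comm a q, pow_mul, hζ.pow_eq_one]
    simp

/-- The modified Glynn formula. -/
theorem torusSum_glynnSummand (A : Matrix (Fin N) (Fin M) ℂ) (m : Config M N) (p : Fin M)
    (ls : List (Fin M)) (hp : p ∉ ls) (hm : ∀ l, l ≠ p → l ∉ ls → m.1 l = 0)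
    (hmin : ∀ l ∈ ls, m.1 p ≤ m.1 l) (w : Fin M → ℂ)
    (hw : ∀ l ∈ ls, w l = Complex.exp (2 * Real.pi * Complex.I / (m.1 l + 1 : ℕ))) :
    torusSum m.1 w (glynnSummand A p ls.toFinset) ls (fun _ => 1) =
      amplitude A m * (ls.map fun l => ((m.1 l + 1 : ℕ) : ℂ)).prod := by
  set S := ls.toFinset with hS
  have hpS : p ∉ S := by simpa [hS] using hp
  let c : Config M N → ℂ := fun m' =>
    if ∀ l, l ∉ insert p S → m'.1 l = 0 then amplitude A m' else 0
  have hg : glynnSummand A p S =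
      fun x => ∑ m' : Config M N, c m' * ∏ l ∈ S, x l ^ (m'.1 l + 1) := by
    funext x
    let z : Fin M → ℂ := fun l => if l ∈ S then x l else if l = p then 1 else 0
    have hz : ∀ k, A k p + ∑ l ∈ S, x l * A k l = ∑ l, A k l * z l := by
      intro k
      rw [← Finset.sum_subset (Finset.subset_univ (insert p S)), Finset.sum_insert hpS]
      · congr 1
        · simp [z, hpS]
        · exact Finset.sum_congr rfl fun l hl => by simp [z, hl, mul_comm]
      · intro l _ hl
        simp only [Finset.mem_insert, not_or] at hl
        simp [z, hl]
    simp only [glynnSummand, hz, prod_sum_eq_sum_amplitude, Finset.mul_sum]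
    refine Finset.sum_congr rfl fun m' _ => ?_
    by_cases h : ∀ l, l ∉ insert p S → m'.1 l = 0
    · have : ∏ l, z l ^ m'.1 l = ∏ l ∈ S, x l ^ m'.1 l := by
        rw [← Finset.prod_subset (Finset.subset_univ (insert p S)) fun l _ hl => by
          rw [h l hl, pow_zero], Finset.prod_insert hpS]
        simp only [z, hpS, if_false, if_true, one_pow, one_mul]
        exact Finset.prod_congr rfl fun l hl => by simp [hl]
      simp only [c, if_pos h, this, pow_succ, Finset.prod_mul_distrib]
      ring
    · simp only [c, if_neg h, zero_mul]
      push Not at h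
      obtain ⟨l, hl, hl0⟩ := h
      rw [Finset.prod_eq_zero (Finset.mem_univ l), mul_zero, mul_zero]
      simp only [Finset.mem_insert, not_or] at hl
      simp [z, hl, hl0]
  rw [hg, torusSum_sum]
  have hm0 : ∀ l, l ∉ insert p S → m.1 l = 0 := fun l hl => by
    simp only [Finset.mem_insert, not_or, hS, List.mem_toFinset] at hl
    exact hm l hl.1 hl.2
  have hsum : ∀ m' : Config M N,
      (ls.map fun l => ∑ j ∈ Finset.range (m.1 l + 1), (w l ^ (m'.1 l + 1)) ^ j) =
      ls.map fun l => if m.1 l + 1 ∣ m'.1 l + 1 then ((m.1 l + 1 : ℕ) : ℂ) else 0 := by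
    intro m'
    refine List.map_congr_left fun l hl => ?_
    rw [hw l hl, sum_pow_rootOfUnity _ _ (by omega)]
  rw [Finset.sum_eq_single m]
  · have hcm : c m = amplitude A m := if_pos hm0
    rw [torusSum_monomial _ _ _ _ _ (by simp [hS]), hsum, hcm]
    simp
  · intro m' _ hne
    rw [torusSum_monomial _ _ _ _ _ (by simp [hS]), hsum]
    by_cases h : ∀ l, l ∉ insert p S → m'.1 l = 0
    · have hnd : ¬ ∀ l ∈ S, m.1 l + 1 ∣ m'.1 l + 1 := fun hd =>
        hne (config_eq_of_dvd m m' p S hpS hm0 h (by simpa [hS] using hmin) hd)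
      push Not at hnd
      obtain ⟨l, hl, hl0⟩ := hnd
      rw [List.prod_eq_zero, zero_mul, mul_zero]
      exact List.mem_map.mpr ⟨l, by simpa [hS] using hl, by simp [hl0]⟩
    · simp only [c, if_neg h, zero_mul]
  · simp

theorem nodup_occupied (m : Fin M → ℕ) : (occupied m).Nodup :=
  (List.nodup_finRange M).filter _

theorem mem_occupied (m : Fin M → ℕ) (l : Fin M) : l ∈ occupied m ↔ 0 < m l := by
  simp [occupied]

theorem prod_occupied_factorials (m : Fin M → ℕ) :
    ((occupied m).flatMap fun l => (List.range (m l)).map fun j => ((j + 1 : ℕ) : ℂ)).prod =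
      ∏ l, ((m l)! : ℂ) := by
  have h1 : ∀ n : ℕ, ((List.range n).map fun j => ((j + 1 : ℕ) : ℂ)).prod = (n ! : ℂ) := by
    intro n
    induction n with
    | zero => simp
    | succ n ih => rw [List.range_succ, List.map_append, List.prod_append, ih, Nat.factorial_succ]
                   push_cast; simp; ring
  rw [List.flatMap, List.prod_flatten, List.map_map]
  simp only [Function.comp_def, h1]
  rw [← List.prod_toFinset _ (nodup_occupied m)]
  refine Finset.prod_subset (Finset.subset_univ _) fun l _ hl => ?_
  have : m l = 0 := by simpa [mem_occupied] using hl
  simp [this]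

/-- The modified Glynn algorithm computes the output probabilities. -/
theorem val_modifiedGlynn (A : Matrix (Fin N) (Fin M) ℂ) (m : Config M N) :
    (modifiedGlynn A m.1).val = ((∏ l, ((m.1 l)! : ℝ)) * ‖amplitude A m‖ ^ 2 : ℝ) := by
  rw [modifiedGlynn]
  split
  next h =>
    rw [List.argmin_eq_none] at h
    have h0 : m.1 = 0 := funext fun l => by
      have := mem_occupied m.1 l
      simp only [h, List.not_mem_nil, false_iff, not_lt, Nat.le_zero] at this
      exact this
    have hN : N = 0 := by rw [← m.2, h0]; simp
    subst hN
    have : amplitude A m = 1 := by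
      rw [amplitude, Finset.filter_true_of_mem]
      · simp
      · exact fun f _ => Subtype.ext (by rw [h0]; funext l; simp [configOf])
    simp [this, h0]
  next p h =>
    have hp : p ∈ occupied m.1 := List.argmin_mem h
    set L := (occupied m.1).erase p with hL
    have hmem : ∀ l, l ∈ L ↔ l ≠ p ∧ 0 < m.1 l := fun l => by
      rw [hL, (nodup_occupied m.1).mem_erase_iff, mem_occupied]
    have hnd : L.Nodup := (nodup_occupied m.1).erase p
    have hw := fun l (hl : l ∈ L) => glynnRoots_val m.1 L l hl
    have hw1 : ∀ l ∈ L, (glynnRoots m.1 L).val l ^ (m.1 l + 1) = 1 := fun l hl => by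
      rw [hw l hl]
      exact (Complex.isPrimitiveRoot_exp _ (by omega)).pow_eq_one
    have hinit : (⟨fun _ => 1, 1, (Counted.tabulate fun k =>
        Counted.addAll (A k p) (L.map (A k))).val, 0⟩ : GlynnState M N) =
        consistentState A p L.toFinset (fun _ => 1) 0 := by
      simp [consistentState, Counted.tabulate, Counted.val_addAll, List.sum_toFinset _ hnd]
    obtain ⟨e, -, hloop⟩ := val_glynnLoop A m.1 (glynnRoots m.1 L).val p L.toFinset L
      (by simp) hnd hw1 (fun _ => 1) 0
    rw [torusSum_glynnSummand A m p L (by simp [hmem])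
      (fun l hl hlL => by
        have := hmem l
        simp only [hlL, false_iff, not_and, not_lt, Nat.le_zero] at this
        exact this hl)
      (fun l hl => List.le_of_mem_argmin (by rw [mem_occupied]; exact ((hmem l).mp hl).2) h)
      _ hw] at hloop
    simp only [Counted.val_bind, hinit, hloop, Counted.div, Counted.mul,
      Counted.conj, Counted.val_prodAll, prod_occupied_factorials]
    simp only [consistentState, zero_add]
    have hd : (L.map fun l => ((m.1 l + 1 : ℕ) : ℂ)).prod ≠ 0 := by
      refine List.prod_ne_zero fun h0 => ?_
      obtain ⟨l, -, hl⟩ := List.mem_map.mp h0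
      exact Nat.cast_ne_zero.mpr (Nat.succ_ne_zero _) hl
    have hf : (∏ l, ((m.1 l)! : ℂ)) ≠ 0 :=
      Finset.prod_ne_zero_iff.mpr fun l _ => by exact_mod_cast (Nat.factorial_pos _).ne'
    rw [mul_div_cancel_right₀ _ hd, map_mul, map_prod]
    simp only [Complex.conj_natCast]
    push_cast
    rw [← Complex.mul_conj']
    field_simp

/-! ### The number of operations -/

/-- The number of summands of the outer sum, for the variables in the given list. -/
def numTerms (m : Fin M → ℕ) (ls : List (Fin M)) : ℕ := (ls.map fun l => m l + 1).prod

theorem ops_glynnRotate (A : Matrix (Fin N) (Fin M) ℂ) (l : Fin M) (w : ℂ)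
    (s : GlynnState M N) : (glynnRotate A l w s).ops = 2 * N + 3 := by
  simp [glynnRotate, Counted.mul, Counted.sub, Counted.add, Counted.tabulate]
  ring

theorem ops_glynnTerm (s : GlynnState M N) : (glynnTerm s).ops = N + 2 := by
  simp [glynnTerm, Counted.mul, Counted.add, Counted.ops_prodAll]

theorem ops_glynnLoop (A : Matrix (Fin N) (Fin M) ℂ) (m : Fin M → ℕ) (w : Fin M → ℂ)
    (ls : List (Fin M)) (s : GlynnState M N) :
    (glynnLoop A m w ls s).ops + (2 * N + 3) = numTerms m ls * (3 * N + 5) := by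
  induction ls generalizing s with
  | nil => simp [glynnLoop, ops_glynnTerm, numTerms]; ring
  | cons l ls ih =>
    have hc : ∀ s, (glynnLoop A m w ls s).ops = numTerms m ls * (3 * N + 5) - (2 * N + 3) :=
      fun s => by rw [← ih s]; simp
    have hge : 2 * N + 3 ≤ numTerms m ls * (3 * N + 5) := by rw [← ih s]; omega
    simp only [glynnLoop, Counted.ops_bind]
    rw [Counted.ops_iter _ (numTerms m ls * (3 * N + 5)), hc]
    · have : numTerms m (l :: ls) = (m l + 1) * numTerms m ls := by simp [numTerms]
      rw [this, add_right_comm, Nat.sub_add_cancel hge]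
      ring
    · intro s
      rw [Counted.ops_bind, ops_glynnRotate, hc]
      omega

theorem ops_glynnRoots (m : Fin M → ℕ) (ls : List (Fin M)) :
    (glynnRoots m ls).ops = ls.length := by
  induction ls with
  | nil => simp [glynnRoots]
  | cons l ls ih => simp [glynnRoots, Counted.rootOfUnity, ih]

theorem numTerms_pos (m : Fin M → ℕ) (ls : List (Fin M)) : 0 < numTerms m ls := by
  induction ls with
  | nil => simp [numTerms]
  | cons l ls ih => simp [numTerms] at ih ⊢

theorem two_pow_length_le_numTerms (m : Fin M → ℕ) (ls : List (Fin M))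
    (h : ∀ l ∈ ls, 0 < m l) : 2 ^ ls.length ≤ numTerms m ls := by
  induction ls with
  | nil => simp [numTerms]
  | cons l ls ih =>
    have h1 := ih fun i hi => h i (by simp [hi])
    have h2 := h l (by simp)
    have : numTerms m (l :: ls) = (m l + 1) * numTerms m ls := by simp [numTerms]
    rw [this, List.length_cons, pow_succ, mul_comm]
    exact Nat.mul_le_mul (by omega) h1

theorem length_factorials (m : Config M N) :
    ((occupied m.1).flatMap fun l =>
      (List.range (m.1 l)).map fun j => ((j + 1 : ℕ) : ℂ)).length = N := by
  simp only [List.length_flatMap, List.length_map, List.length_range]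
  rw [← List.sum_toFinset _ (nodup_occupied m.1)]
  refine Eq.trans ?_ m.2
  refine Finset.sum_subset (Finset.subset_univ _) fun l _ hl => ?_
  simpa [mem_occupied] using hl

/-- The cost of the algorithm is of the order of `N` times the number of summands. -/
theorem ops_modifiedGlynn (A : Matrix (Fin N) (Fin M) ℂ) (m : Config M N) (hN : 0 < N) :
    ∃ p ∈ occupied m.1,
      N * numTerms m.1 ((occupied m.1).erase p) ≤ (modifiedGlynn A m.1).ops ∧
      (modifiedGlynn A m.1).ops ≤ 13 * (N * numTerms m.1 ((occupied m.1).erase p)) := by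
  rw [modifiedGlynn]
  split
  next h =>
    rw [List.argmin_eq_none] at h
    exfalso
    have h0 : m.1 = 0 := funext fun l => by
      have := mem_occupied m.1 l
      simp only [h, List.not_mem_nil, false_iff, not_lt, Nat.le_zero] at this
      exact this
    have : N = 0 := by rw [← m.2, h0]; simp
    omega
  next p h =>
    refine ⟨p, List.argmin_mem h, ?_⟩
    have hpos : ∀ l ∈ (occupied m.1).erase p, 0 < m.1 l := fun l hl =>
      (mem_occupied _ _).mp (List.mem_of_mem_erase hl)
    generalize (occupied m.1).erase p = L at hpos ⊢
    have hT := two_pow_length_le_numTerms m.1 L hpos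
    have hlen : L.length < 2 ^ L.length := Nat.lt_two_pow_self
    have hloop := ops_glynnLoop A m.1 (glynnRoots m.1 L).val L (⟨fun _ => 1, 1,
      (Counted.tabulate fun k => Counted.addAll (A k p) (L.map (A k))).val, 0⟩)
    simp only [Counted.ops_bind, ops_glynnRoots, Counted.ops_prodAll, Counted.div, Counted.mul,
      Counted.conj, length_factorials, List.length_map]
    have htab : (Counted.tabulate fun k : Fin N =>
        Counted.addAll (A k p) (L.map (A k))).ops = N * L.length := by
      simp [Counted.tabulate, Counted.ops_addAll]
    rw [htab]
    have hT0 := numTerms_pos m.1 L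
    generalize (glynnLoop A m.1 _ L _).ops = c at hloop ⊢
    generalize numTerms m.1 L = T at *
    have h1 : L.length ≤ T := by omega
    have h2 : N * L.length ≤ N * T := Nat.mul_le_mul_left _ h1
    have h3 : T ≤ N * T := Nat.le_mul_of_pos_left _ hN
    have h4 : N ≤ N * T := Nat.le_mul_of_pos_right _ hT0
    have h5 : T * (3 * N + 5) = 3 * (N * T) + 5 * T := by ring
    constructor <;> omega

end Glynn

/-! ### Tails of the hypergeometric distribution -/

theorem choose_mul_pow_le {a n : ℕ} (h : a ≤ n) (k : ℕ) :
    a.choose k * n ^ k ≤ n.choose k * a ^ k := by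
  have hd : a.descFactorial k * n ^ k ≤ n.descFactorial k * a ^ k := by
    induction k with
    | zero => simp
    | succ k ih =>
      have h1 : (a - k) * n ≤ (n - k) * a := by
        rw [Nat.sub_mul, Nat.sub_mul, mul_comm n a]
        exact Nat.sub_le_sub_left (Nat.mul_le_mul_left k h) _
      calc a.descFactorial (k + 1) * n ^ (k + 1)
          = ((a - k) * n) * (a.descFactorial k * n ^ k) := by
            rw [Nat.descFactorial_succ]; ring
        _ ≤ ((n - k) * a) * (n.descFactorial k * a ^ k) := Nat.mul_le_mul h1 ih
        _ = n.descFactorial (k + 1) * a ^ (k + 1) := by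
            rw [Nat.descFactorial_succ]; ring
  rw [Nat.descFactorial_eq_factorial_mul_choose, Nat.descFactorial_eq_factorial_mul_choose,
    mul_assoc, mul_assoc] at hd
  exact Nat.le_of_mul_le_mul_left hd (Nat.factorial_pos k)

/-- The `k`-th factorial moment of the hypergeometric distribution, up to normalization. -/
theorem sum_choose_mul_choose_mul_choose (a b N k : ℕ) (hk : k ≤ N) :
    ∑ ij ∈ Finset.HasAntidiagonal.antidiagonal N, a.choose ij.1 * b.choose ij.2 * ij.1.choose k =
      a.choose k * (a + b - k).choose (N - k) := by
  rcases lt_or_ge a k with hak | hak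
  · rw [Nat.choose_eq_zero_of_lt hak, zero_mul]
    refine Finset.sum_eq_zero fun ij _ => ?_
    rcases lt_or_ge ij.1 k with h | h
    · rw [Nat.choose_eq_zero_of_lt h, mul_zero]
    · rw [Nat.choose_eq_zero_of_lt (hak.trans_le h), zero_mul, zero_mul]
  · rw [Nat.sub_add_comm hak, Nat.add_choose_eq, Finset.mul_sum]
    symm
    refine Finset.sum_of_injOn (fun ij => (ij.1 + k, ij.2)) ?_ ?_ ?_ ?_
    · rintro ⟨i, j⟩ _ ⟨i', j'⟩ _ h
      simpa using h
    · rintro ⟨i, j⟩ h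
      simp only [Finset.mem_coe, Finset.HasAntidiagonal.mem_antidiagonal] at h ⊢
      omega
    · rintro ⟨i, j⟩ h hn
      rw [Finset.HasAntidiagonal.mem_antidiagonal] at h
      rw [Nat.choose_eq_zero_of_lt (n := i), mul_zero]
      by_contra! hik
      exact hn ⟨(i - k, j),
        by simp only [Finset.mem_coe, Finset.HasAntidiagonal.mem_antidiagonal]; omega,
        by simp only [Prod.mk.injEq, and_true]; omega⟩
    · rintro ⟨i, j⟩ h
      have h1 := Nat.choose_mul (n := a) (k := i + k) (s := k) (by omega)
      rw [Nat.add_sub_cancel] at h1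
      dsimp only
      rw [mul_right_comm, h1, mul_assoc]

/-- The generating function of the hypergeometric distribution is bounded by the one of the
binomial distribution, because its factorial moments are. -/
theorem sum_hypergeometric_mul_pow_le (a b N : ℕ) (h : 0 < a + b) (y : ℝ) (hy : 0 ≤ y) :
    ∑ ij ∈ Finset.HasAntidiagonal.antidiagonal N,
        (a.choose ij.1 * b.choose ij.2 : ℝ) * (1 + y) ^ ij.1 ≤
      (a + b).choose N * (1 + y * (a / (a + b : ℕ))) ^ N := by
  have hexp : ∀ ij ∈ Finset.HasAntidiagonal.antidiagonal N,
      (a.choose ij.1 * b.choose ij.2 : ℝ) * (1 + y) ^ ij.1 =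
      ∑ k ∈ Finset.range (N + 1),
        y ^ k * ((a.choose ij.1 * b.choose ij.2 * ij.1.choose k : ℕ) : ℝ) := by
    intro ij hij
    rw [add_comm, add_pow, Finset.mul_sum]
    rw [Finset.sum_subset (Finset.range_subset_range.mpr
      (Nat.succ_le_succ (show ij.1 ≤ N by
        rw [Finset.HasAntidiagonal.mem_antidiagonal] at hij; omega)))]
    · refine Finset.sum_congr rfl fun k _ => ?_
      push_cast; ring
    · intro k _ hk
      rw [Nat.choose_eq_zero_of_lt (show ij.1 < k by simpa using hk)]
      simp
  rw [Finset.sum_congr rfl hexp, Finset.sum_comm, add_comm 1 (y * _), add_pow, Finset.mul_sum]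
  refine Finset.sum_le_sum fun k hk => ?_
  have hk : k ≤ N := by simpa [Nat.lt_succ_iff] using hk
  rw [← Finset.mul_sum, ← Nat.cast_sum, sum_choose_mul_choose_mul_choose a b N k hk, one_pow,
    mul_one]
  have hn : (0 : ℝ) < (a + b : ℕ) := by exact_mod_cast h
  have h1 : (a.choose k : ℝ) ≤ (a + b).choose k * (a / (a + b : ℕ)) ^ k := by
    rw [div_pow, ← mul_div_assoc, le_div_iff₀ (by positivity)]
    exact_mod_cast choose_mul_pow_le (Nat.le_add_right a b) k
  have h2 : (((a + b).choose N * N.choose k : ℕ) : ℝ) =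
      ((a + b).choose k * (a + b - k).choose (N - k) : ℕ) := by
    rw [Nat.choose_mul hk]
  push_cast at h2 ⊢
  calc y ^ k * (a.choose k * (a + b - k).choose (N - k) : ℝ)
      ≤ y ^ k * (((a + b).choose k * (a / (a + b : ℕ)) ^ k) * (a + b - k).choose (N - k)) := by
        gcongr
    _ = (y ^ k * (a / (a + b : ℕ)) ^ k) *
          (((a + b).choose k : ℝ) * (a + b - k).choose (N - k)) := by ring
    _ = _ := by rw [← h2]; push_cast; ring

open MeasureTheory in
/-- Hoeffding's lemma for the Bernoulli distribution. -/
theorem bernoulli_mgf_le (p t : ℝ) (h0 : 0 ≤ p) (h1 : p ≤ 1) :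
    1 + (Real.exp t - 1) * p ≤ Real.exp (p * t + t ^ 2 / 8) := by
  let μ : Measure ℝ := ENNReal.ofReal p • Measure.dirac 1 + ENNReal.ofReal (1 - p) • Measure.dirac 0
  have hint : ∀ f : ℝ → ℝ, ∫ x, f x ∂μ = p * f 1 + (1 - p) * f 0 := by
    intro f
    rw [integral_add_measure, integral_smul_measure, integral_smul_measure, integral_dirac,
      integral_dirac, ENNReal.toReal_ofReal h0, ENNReal.toReal_ofReal (by linarith)]
    · rfl
    · exact (integrable_dirac (by simp)).smul_measure ENNReal.ofReal_ne_top
    · exact (integrable_dirac (by simp)).smul_measure ENNReal.ofReal_ne_top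
  have : IsProbabilityMeasure μ := ⟨by
    simp only [μ, Measure.add_apply, Measure.smul_apply, measure_univ, smul_eq_mul, mul_one]
    rw [← ENNReal.ofReal_add h0 (by linarith)]
    simp⟩
  have hb : ∀ᵐ x ∂μ, (id x : ℝ) ∈ Set.Icc (0 : ℝ) 1 := by
    rw [ae_add_measure_iff]
    constructor <;> refine Measure.ae_smul_measure ?_ _ <;> 
      exact (ae_dirac_iff measurableSet_Icc).mpr (by simp)
  have hh := (ProbabilityTheory.hasSubgaussianMGF_of_mem_Icc (μ := μ) (X := id)
    aemeasurable_id hb).mgf_le t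
  simp only [ProbabilityTheory.mgf, hint] at hh
  have hm : p * Real.exp (t * (1 - p)) + (1 - p) * Real.exp (-(t * p)) =
      (1 + (Real.exp t - 1) * p) / Real.exp (p * t) := by
    rw [show t * (1 - p) = t - p * t by ring, Real.exp_sub, mul_comm t p, Real.exp_neg]
    ring
  simp at hh
  rw [hm, div_le_iff₀ (Real.exp_pos _), ← Real.exp_add] at hh
  rw [show p * t + t ^ 2 / 8 = ((2 : ℝ) ^ 2)⁻¹ * t ^ 2 / 2 + p * t by ring]
  exact hh

/-- Hoeffding's inequality for the hypergeometric distribution: `N` draws without replacement from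
`a` marked and `b` unmarked objects. -/
theorem hypergeometric_tail_le (a b N : ℕ) (hN : 0 < N) (h : 0 < a + b) (s : ℝ) (hs : 0 ≤ s)
    (P : ℕ → Prop) [DecidablePred P] (hP : ∀ i, P i → N * (a / (a + b : ℕ) : ℝ) + s ≤ i) :
    ∑ ij ∈ Finset.HasAntidiagonal.antidiagonal N with P ij.1,
        (a.choose ij.1 * b.choose ij.2 : ℝ) ≤
      (a + b).choose N * Real.exp (-2 * s ^ 2 / N) := by
  have hN' : (0 : ℝ) < N := by exact_mod_cast hN
  have hn : (0 : ℝ) < (a + b : ℕ) := by exact_mod_cast h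
  set p : ℝ := a / (a + b : ℕ) with hp
  have hp0 : 0 ≤ p := by positivity
  have hp1 : p ≤ 1 := by
    rw [hp, div_le_one hn]
    exact_mod_cast Nat.le_add_right a b
  -- The exponent at which the Chernoff bound is optimal.
  set t : ℝ := 4 * s / N with ht
  have ht0 : 0 ≤ t := by positivity
  calc ∑ ij ∈ Finset.HasAntidiagonal.antidiagonal N with P ij.1,
        (a.choose ij.1 * b.choose ij.2 : ℝ)
      ≤ ∑ ij ∈ Finset.HasAntidiagonal.antidiagonal N with P ij.1,
        Real.exp (-(t * (N * p + s))) * ((a.choose ij.1 * b.choose ij.2 : ℝ) *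
          (1 + (Real.exp t - 1)) ^ ij.1) := by
        refine Finset.sum_le_sum fun ij hij => ?_
        have hi := hP ij.1 (Finset.mem_filter.mp hij).2
        have h1 : 1 ≤ Real.exp (-(t * (N * p + s))) * (1 + (Real.exp t - 1)) ^ ij.1 := by
          rw [add_sub_cancel, ← Real.exp_nat_mul, ← Real.exp_add]
          apply Real.one_le_exp
          nlinarith
        nlinarith [mul_nonneg (Nat.cast_nonneg (α := ℝ) (a.choose ij.1))
          (Nat.cast_nonneg (α := ℝ) (b.choose ij.2))]
    _ ≤ ∑ ij ∈ Finset.HasAntidiagonal.antidiagonal N,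
        Real.exp (-(t * (N * p + s))) * ((a.choose ij.1 * b.choose ij.2 : ℝ) *
          (1 + (Real.exp t - 1)) ^ ij.1) := by
        refine Finset.sum_le_sum_of_subset_of_nonneg (Finset.filter_subset _ _) fun ij _ _ => ?_
        rw [add_sub_cancel]
        positivity
    _ ≤ Real.exp (-(t * (N * p + s))) *
        ((a + b).choose N * (1 + (Real.exp t - 1) * p) ^ N) := by
        rw [← Finset.mul_sum]
        refine mul_le_mul_of_nonneg_left ?_ (Real.exp_pos _).le
        exact sum_hypergeometric_mul_pow_le a b N h _ (by linarith [Real.add_one_le_exp t])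
    _ ≤ Real.exp (-(t * (N * p + s))) *
        ((a + b).choose N * Real.exp (p * t + t ^ 2 / 8) ^ N) := by
        have h0 : 0 ≤ 1 + (Real.exp t - 1) * p := by
          have := mul_nonneg (sub_nonneg.mpr (Real.one_le_exp ht0)) hp0
          linarith
        have := bernoulli_mgf_le p t hp0 hp1
        gcongr
    _ = (a + b).choose N * Real.exp (-2 * s ^ 2 / N) := by
        rw [← Real.exp_nat_mul, mul_left_comm, ← Real.exp_add]
        congr 2
        rw [ht]
        field_simp
        ring

/-! ### The number of occupied ports of a uniformly distributed configuration -/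

section Counting

variable {M N : ℕ}

/-- The number of occupied output ports. -/
def numOccupied (m : Config M N) : ℕ := (Finset.univ.filter fun l => 0 < m.1 l).card

theorem length_occupied (m : Config M N) : (occupied m.1).length = numOccupied m := by
  rw [numOccupied, ← List.toFinset_card_of_nodup (nodup_occupied m.1)]
  congr 1
  ext l
  simp [mem_occupied]

theorem numOccupied_le (m : Config M N) : numOccupied m ≤ N := by
  conv_rhs => rw [← m.2]
  rw [numOccupied, Finset.card_eq_sum_ones, Finset.sum_filter]
  refine Finset.sum_le_sum fun l _ => ?_
  split_ifs with h
  · exact h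
  · exact Nat.zero_le _

theorem card_piAntidiag {ι : Type*} [DecidableEq ι] (s : Finset ι) (n : ℕ) :
    (s.piAntidiag n).card = (s.card + n - 1).choose n := by
  rw [← Finset.card_finsuppAntidiag_nat_eq_choose, Finset.finsuppAntidiag, Finset.card_map,
    Finset.card_attach]

/-- Configurations in which exactly the ports of `S` are occupied arise from configurations of
`N - |S|` bosons in these ports by adding one boson to each of them. -/
theorem card_config_support (S : Finset (Fin M)) (hS : S.card ≤ N) (hN : 0 < N) :
    (Finset.univ.filter fun m : Config M N => (Finset.univ.filter fun l => 0 < m.1 l) = S).card =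
      (N - 1).choose (N - S.card) := by
  have h1 := card_piAntidiag S (N - S.card)
  rw [show S.card + (N - S.card) - 1 = N - 1 by omega] at h1
  rw [← h1]
  refine Finset.card_bij (fun m _ l => m.1 l - 1) ?_ ?_ ?_
  · intro m hm
    obtain rfl := (Finset.mem_filter.mp hm).2
    rw [Finset.mem_piAntidiag]
    constructor
    · have h2 : ∑ l with 0 < m.1 l, (m.1 l - 1) + ∑ l with 0 < m.1 l, 1 = N := by
        rw [← Finset.sum_add_distrib]
        refine Eq.trans ?_ m.2
        rw [Finset.sum_filter]
        refine Finset.sum_congr rfl fun l _ => ?_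
        split_ifs <;> omega
      rw [Finset.card_eq_sum_ones]
      omega
    · intro l hl
      simp only [Finset.mem_filter, Finset.mem_univ, true_and]
      omega
  · intro m hm m' hm' h
    have hm := (Finset.mem_filter.mp hm).2
    have hm' := (Finset.mem_filter.mp hm').2
    apply Subtype.ext
    funext l
    have h2 := congrFun h l
    have h3 : 0 < m.1 l ↔ l ∈ S := by rw [← hm]; simp
    have h4 : 0 < m'.1 l ↔ l ∈ S := by rw [← hm']; simp
    by_cases hl : l ∈ S
    · have := h3.mpr hl; have := h4.mpr hl; omega
    · have := mt h3.mp hl; have := mt h4.mp hl; omega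
  · intro c hc
    obtain ⟨hc1, hc2⟩ := Finset.mem_piAntidiag.mp hc
    refine ⟨⟨fun l => c l + if l ∈ S then 1 else 0, ?_⟩, ?_, ?_⟩
    · rw [Finset.sum_add_distrib, Finset.sum_ite_mem, Finset.univ_inter, ← Finset.card_eq_sum_ones,
        ← Finset.sum_subset (Finset.subset_univ S) fun l _ hl => by
          by_contra h; exact hl (hc2 l h), hc1]
      omega
    · refine Finset.mem_filter.mpr ⟨Finset.mem_univ _, ?_⟩
      ext l
      simp only [Finset.mem_filter, Finset.mem_univ, true_and]
      by_cases hl : l ∈ S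
      · simp [hl]
      · have := mt (hc2 l) hl
        simp [hl]; omega
    · funext l
      by_cases hl : l ∈ S
      · simp [hl]
      · have := mt (hc2 l) hl
        simp [hl]; omega

theorem card_numOccupied_eq (hN : 0 < N) (n : ℕ) (hn : n ≤ N) :
    (Finset.univ.filter fun m : Config M N => numOccupied m = n).card =
      M.choose n * (N - 1).choose (N - n) := by
  rw [Finset.card_eq_sum_card_fiberwise
    (f := fun m : Config M N => Finset.univ.filter fun l => 0 < m.1 l)
    (t := Finset.powersetCard n Finset.univ)]
  · rw [Finset.sum_congr rfl (g := fun _ => (N - 1).choose (N - n)), Finset.sum_const,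
      Finset.card_powersetCard, Finset.card_univ, Fintype.card_fin, smul_eq_mul]
    intro S hS
    have hS := (Finset.mem_powersetCard.mp hS).2
    rw [← hS, ← card_config_support S (by omega) hN, Finset.filter_filter]
    congr 1
    ext m
    simp only [Finset.mem_filter, Finset.mem_univ, true_and, and_iff_right_iff_imp]
    rintro rfl
    rfl
  · intro m hm
    have hm : numOccupied m = n := by simpa using hm
    exact Finset.mem_coe.mpr (Finset.mem_powersetCard.mpr ⟨Finset.subset_univ _, hm⟩)

/-- The number of occupied ports of a uniformly distributed configuration has a hypergeometric
distribution. -/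
theorem card_numOccupied (hN : 0 < N) (P : ℕ → Prop) [DecidablePred P] :
    (Finset.univ.filter fun m : Config M N => P (numOccupied m)).card =
      ∑ ij ∈ Finset.HasAntidiagonal.antidiagonal N with P ij.1,
        M.choose ij.1 * (N - 1).choose ij.2 := by
  rw [Finset.card_eq_sum_card_fiberwise
    (f := fun m : Config M N => (numOccupied m, N - numOccupied m))
    (t := (Finset.HasAntidiagonal.antidiagonal N).filter fun ij => P ij.1)]
  · refine Finset.sum_congr rfl fun ij hij => ?_
    obtain ⟨h1, h2⟩ := Finset.mem_filter.mp hij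
    rw [Finset.HasAntidiagonal.mem_antidiagonal] at h1
    have h3 := card_numOccupied_eq (M := M) hN ij.1 (by omega)
    rw [show N - ij.1 = ij.2 by omega] at h3
    rw [← h3, Finset.filter_filter]
    congr 1
    ext m
    simp only [Finset.mem_filter, Finset.mem_univ, true_and, Prod.ext_iff]
    constructor
    · exact fun h => h.2.1
    · intro h
      exact ⟨h ▸ h2, h, by omega⟩
  · intro m hm
    have := numOccupied_le m
    simp only [Finset.coe_filter, Finset.mem_univ, true_and] at hm
    refine Finset.mem_coe.mpr (Finset.mem_filter.mpr ⟨?_, hm⟩)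
    rw [Finset.HasAntidiagonal.mem_antidiagonal]
    exact Nat.add_sub_cancel' this

theorem card_config (hN : 0 < N) : Fintype.card (Config M N) = (M + (N - 1)).choose N := by
  have := card_numOccupied (M := M) hN fun _ => True
  simpa [Nat.add_choose_eq] using this

/-- Upper tail of the number of occupied ports. -/
theorem card_numOccupied_ge_le (hN : 0 < N) (hM : 0 < M) (s : ℝ) (hs : 0 ≤ s)
    (P : ℕ → Prop) [DecidablePred P]
    (hP : ∀ i, P i → N * (M / (M + (N - 1) : ℕ) : ℝ) + s ≤ i) :
    ((Finset.univ.filter fun m : Config M N => P (numOccupied m)).card : ℝ) ≤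
      Fintype.card (Config M N) * Real.exp (-2 * s ^ 2 / N) := by
  rw [card_numOccupied hN P, card_config hN]
  have := hypergeometric_tail_le M (N - 1) N hN (by omega) s hs P hP
  push_cast
  exact this

/-- Lower tail of the number of occupied ports. -/
theorem card_numOccupied_le_le (hN : 0 < N) (hM : 0 < M) (s : ℝ) (hs : 0 ≤ s)
    (P : ℕ → Prop) [DecidablePred P]
    (hP : ∀ i, i ≤ N → P i → (i : ℝ) + s ≤ N * (M / (M + (N - 1) : ℕ) : ℝ)) :
    ((Finset.univ.filter fun m : Config M N => P (numOccupied m)).card : ℝ) ≤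
      Fintype.card (Config M N) * Real.exp (-2 * s ^ 2 / N) := by
  classical
  rw [card_numOccupied hN P, card_config hN, add_comm M]
  have := hypergeometric_tail_le (N - 1) M N hN (by omega) s hs (fun j => j ≤ N ∧ P (N - j)) (by
    rintro j ⟨hj, h⟩
    have h1 := hP (N - j) (Nat.sub_le _ _) h
    rw [Nat.cast_sub hj] at h1
    have h2 : (0 : ℝ) < (M + (N - 1) : ℕ) := by exact_mod_cast (by omega : 0 < M + (N - 1))
    have h3 : (((N - 1 : ℕ) : ℝ) / (N - 1 + M : ℕ)) = 1 - M / (M + (N - 1) : ℕ) := by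
      rw [add_comm (N - 1) M, eq_sub_iff_add_eq, ← add_div, div_eq_one_iff_eq h2.ne']
      push_cast; ring
    rw [h3]
    linarith)
  refine le_trans (le_of_eq ?_) this
  push_cast
  refine Finset.sum_bij (fun ij _ => ij.swap) ?_ ?_ ?_ ?_
  · rintro ⟨i, j⟩ h
    simp only [Finset.mem_filter, Finset.HasAntidiagonal.mem_antidiagonal, Prod.swap] at h ⊢
    exact ⟨by omega, by omega, by rw [show N - j = i by omega]; exact h.2⟩
  · intro x _ y _ h
    exact Prod.swap_injective h
  · rintro ⟨i, j⟩ h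
    simp only [Finset.mem_filter, Finset.HasAntidiagonal.mem_antidiagonal] at h
    refine ⟨(j, i), ?_, rfl⟩
    simp only [Finset.mem_filter, Finset.HasAntidiagonal.mem_antidiagonal]
    exact ⟨by omega, by rw [show j = N - i by omega]; exact h.2.2⟩
  · rintro ⟨i, j⟩ _
    exact mul_comm _ _

end Counting

/-! ### The bounds on the number of operations -/

section Bounds

variable {M N : ℕ}

theorem ops_modifiedGlynn_congr (A B : Matrix (Fin N) (Fin M) ℂ) (m : Fin M → ℕ) :
    (modifiedGlynn A m).ops = (modifiedGlynn B m).ops := by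
  rw [modifiedGlynn, modifiedGlynn]
  split
  · rfl
  next p h =>
    have hloop : ∀ (L : List (Fin M)) (w w' : Fin M → ℂ) (s s' : GlynnState M N),
        (glynnLoop A m w L s).ops = (glynnLoop B m w' L s').ops := fun L w w' s s' => by
      have h1 := ops_glynnLoop A m w L s
      have h2 := ops_glynnLoop B m w' L s'
      omega
    simp only [Counted.ops_bind, Counted.ops_prodAll, Counted.div, Counted.mul, Counted.conj,
      Counted.tabulate, Counted.ops_addAll, List.length_map]
    rw [hloop]

theorem withinBounds_congr (c C ε : ℝ) (h : N ≤ M) (U V : Matrix.unitaryGroup (Fin M) ℂ)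
    (m : Config M N) : WithinBounds c C ε h U m ↔ WithinBounds c C ε h V m := by
  rw [WithinBounds, WithinBounds, glynnProb, glynnProb, ops_modifiedGlynn_congr]

theorem log_numTerms_le (m : Fin M → ℕ) (ls : List (Fin M)) (r : ℝ) (hr : 0 ≤ r) :
    Real.log (numTerms m ls) ≤
      ls.length * Real.log (1 + r) + (((ls.map m).sum : ℕ) - ls.length * r) / (1 + r) := by
  induction ls with
  | nil => simp [numTerms]
  | cons l ls ih =>
    have h0 : (0 : ℝ) < 1 + r := by linarith
    have h1 : numTerms m (l :: ls) = (m l + 1) * numTerms m ls := by simp [numTerms]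
    have h2 : (0 : ℝ) < numTerms m ls := by exact_mod_cast numTerms_pos m ls
    have h3 : Real.log ((m l : ℝ) + 1) ≤ Real.log (1 + r) + (m l - r) / (1 + r) := by
      have := Real.log_le_sub_one_of_pos (x := ((m l : ℝ) + 1) / (1 + r)) (by positivity)
      rw [Real.log_div (by positivity) h0.ne'] at this
      have h4 : ((m l : ℝ) + 1) / (1 + r) - 1 = (m l - r) / (1 + r) := by
        field_simp; ring
      linarith
    have h5 : ((m l : ℝ) + ((ls.map m).sum : ℕ) - (ls.length + 1) * r) / (1 + r) =
        (m l - r) / (1 + r) + (((ls.map m).sum : ℕ) - ls.length * r) / (1 + r) := by ring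
    rw [h1, List.map_cons, List.sum_cons, List.length_cons]
    simp only [Nat.cast_mul, Nat.cast_add, Nat.cast_one]
    rw [Real.log_mul (by positivity) h2.ne', h5]
    linarith

theorem sum_occupied (m : Config M N) : ((occupied m.1).map m.1).sum = N := by
  rw [← List.sum_toFinset _ (nodup_occupied m.1)]
  refine Eq.trans ?_ m.2
  refine Finset.sum_subset (Finset.subset_univ _) fun l _ hl => ?_
  simpa [mem_occupied] using hl

/-- `n` factors with the sum of the occupations equal to `N` have product at most
`(1 + N / n) ^ n`, which increases with `n`, up to the value for `n = N / r`. Both facts are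
contained in the tangent of the logarithm at `1 + r`. -/
theorem numTerms_occupied_le (m : Config M N) (r : ℝ) (hr : 0 < r)
    (h : (numOccupied m : ℝ) ≤ N / r) :
    (numTerms m.1 (occupied m.1) : ℝ) ≤ (1 + r) ^ ((N : ℝ) / r) := by
  have h0 : (0 : ℝ) < 1 + r := by linarith
  have h1 := log_numTerms_le m.1 (occupied m.1) r hr.le
  rw [sum_occupied, length_occupied] at h1
  have h2 : (0 : ℝ) < numTerms m.1 (occupied m.1) := by exact_mod_cast numTerms_pos _ _
  rw [← Real.log_le_log_iff h2 (Real.rpow_pos_of_pos h0 _), Real.log_rpow h0]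
  have h3 : r / (1 + r) ≤ Real.log (1 + r) := by
    have := Real.one_sub_inv_le_log_of_pos h0
    have h4 : r / (1 + r) = 1 - (1 + r)⁻¹ := by field_simp; ring
    linarith
  have h4 : ((N : ℝ) - numOccupied m * r) / (1 + r) = (N / r - numOccupied m) * (r / (1 + r)) := by
    field_simp
  have h5 : (N / r - numOccupied m) * (r / (1 + r)) ≤
      (N / r - numOccupied m) * Real.log (1 + r) :=
    mul_le_mul_of_nonneg_left h3 (sub_nonneg.mpr h)
  rw [h4] at h1
  linarith

theorem withinBounds_of_numOccupied (ε : ℝ) (h : N ≤ M) (hN : 0 < N)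
    (U : Matrix.unitaryGroup (Fin M) ℂ) (m : Config M N)
    (hlow : (1 - deviation M N ε) * N / (1 + density M N) ≤ numOccupied m)
    (hup : (numOccupied m : ℝ) ≤ N / rate M N ε) :
    WithinBounds (1 / 2) 13 ε h U m := by
  obtain ⟨p, hp, h1, h2⟩ := ops_modifiedGlynn
    (Matrix.of fun (k : Fin N) (l : Fin M) => U.1 (Fin.castLE h k) l) m hN
  set T := numTerms m.1 ((occupied m.1).erase p) with hT
  have hr : 0 < rate M N ε := lt_of_lt_of_le one_pos (le_max_left _ _)
  have hlen : ((occupied m.1).erase p).length + 1 = numOccupied m := by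
    rw [List.length_erase_of_mem hp, ← length_occupied]
    exact Nat.sub_add_cancel (List.length_pos_of_mem hp)
  have hTle : T ≤ numTerms m.1 (occupied m.1) := by
    have h3 : numTerms m.1 (occupied m.1) = (m.1 p + 1) * T := by
      rw [numTerms, ((List.perm_cons_erase hp).map _).prod_eq]
      simp [hT, numTerms]
    rw [h3]
    exact Nat.le_mul_of_pos_left _ (Nat.succ_pos _)
  have hTge : 2 ^ numOccupied m ≤ 2 * T := by
    rw [← hlen, pow_succ, mul_comm]
    exact Nat.mul_le_mul_left _ (two_pow_length_le_numTerms _ _ fun l hl =>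
      (mem_occupied _ _).mp (List.mem_of_mem_erase hl))
  have hN0 : (0 : ℝ) ≤ N := Nat.cast_nonneg N
  constructor
  · have h3 : (2 : ℝ) ^ ((1 - deviation M N ε) * N / (1 + density M N)) ≤ 2 * T := by
      calc (2 : ℝ) ^ ((1 - deviation M N ε) * N / (1 + density M N))
          ≤ (2 : ℝ) ^ (numOccupied m : ℝ) := Real.rpow_le_rpow_of_exponent_le one_le_two hlow
        _ ≤ 2 * T := by rw [Real.rpow_natCast]; exact_mod_cast hTge
    calc 1 / 2 * (N * (2 : ℝ) ^ ((1 - deviation M N ε) * N / (1 + density M N)))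
        ≤ 1 / 2 * (N * (2 * T)) := by gcongr
      _ = ((N * T : ℕ) : ℝ) := by push_cast; ring
      _ ≤ _ := by exact_mod_cast h1
  · calc ((glynnProb h U m).ops : ℝ) ≤ ((13 * (N * T) : ℕ) : ℝ) := by exact_mod_cast h2
      _ = 13 * (N * (T : ℝ)) := by push_cast; ring
      _ ≤ 13 * (N * (1 + rate M N ε) ^ (N / rate M N ε)) := by
        have h3 : (T : ℝ) ≤ (1 + rate M N ε) ^ (N / rate M N ε) :=
          le_trans (by exact_mod_cast hTle) (numTerms_occupied_le m _ hr hup)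
        gcongr

/-- Under the uniform distribution on the configurations, the bounds fail with probability at
most `ε ^ 2`. -/
theorem card_not_withinBounds_le (ε : ℝ) (hε : 0 < ε) (hε1 : ε < 1) (h : N ≤ M) (hN : 16 ≤ N)
    (U : Matrix.unitaryGroup (Fin M) ℂ) [DecidablePred (WithinBounds (1 / 2) 13 ε h U)] :
    ((Finset.univ.filter fun m : Config M N => ¬ WithinBounds (1 / 2) 13 ε h U m).card : ℝ) ≤
      Fintype.card (Config M N) * ε ^ 2 := by
  classical
  have hN0 : (16 : ℝ) ≤ N := by exact_mod_cast hN
  have hM0 : (N : ℝ) ≤ M := by exact_mod_cast h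
  have hMp : (0 : ℝ) < M := by linarith
  set ρ := density M N with hρ
  set δ := deviation M N ε with hδ
  have hρ0 : 0 < ρ := by rw [hρ, density]; exact div_pos (by linarith) hMp
  have hρ1 : ρ ≤ 1 := by rw [hρ, density, div_le_one hMp]; exact hM0
  set a := Real.log (2 / ε) with ha
  have ha1 : 0.69 ≤ a := by
    have h1 : Real.log 2 ≤ a :=
      Real.log_le_log two_pos (by rw [le_div_iff₀ hε]; linarith)
    have := Real.log_two_gt_d9
    linarith
  have hδ0 : 0 ≤ δ := by rw [hδ, deviation]; positivity
  have hδ2 : δ ^ 2 = 4 * ((1 + ρ) / N * a) := by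
    rw [hδ, deviation, mul_pow, Real.sq_sqrt (mul_nonneg (by positivity) (by linarith)), hρ, ha]
    ring
  set μ := N / (1 + ρ) with hμ
  set D := δ * μ with hD
  have hμ0 : 0 < μ := by positivity
  have hD0 : 0 ≤ D := by positivity
  have hD2 : 2 * a ≤ D ^ 2 / N := by
    have h1 : D ^ 2 / N = 4 * a / (1 + ρ) := by
      rw [hD, mul_pow, hδ2, hμ]; field_simp
    rw [h1, le_div_iff₀ (by linarith)]
    nlinarith
  have hD4 : 4 ≤ D := by
    rw [le_div_iff₀ (by linarith)] at hD2
    nlinarith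
  have hexp : Real.exp (-(2 * a)) = (ε / 2) ^ 2 := by
    rw [show -(2 * a) = ((2 : ℕ) : ℝ) * (-a) by push_cast; ring, Real.exp_nat_mul, ha,
      ← Real.log_inv,
      Real.exp_log (by positivity), inv_div]
  have hμ' : μ = N * M / (M + N) := by
    rw [hμ, hρ, density]; field_simp
  have hcast : ((M + (N - 1) : ℕ) : ℝ) = M + N - 1 := by
    rw [Nat.cast_add, Nat.cast_sub (by omega)]; push_cast; ring
  -- The mean number of occupied ports exceeds `μ` by at most one.
  have hmean1 : μ ≤ N * (M / (M + (N - 1) : ℕ)) := by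
    rw [hμ', hcast, ← mul_div_assoc]
    gcongr <;> linarith
  have hmean2 : N * (M / (M + (N - 1) : ℕ) : ℝ) ≤ μ + 1 := by
    rw [hμ', hcast, ← mul_div_assoc, div_add_one (by linarith),
      div_le_div_iff₀ (by linarith) (by linarith)]
    nlinarith
  have hlow := card_numOccupied_le_le (M := M) (N := N) (by omega) (by omega) D hD0
    (fun i => (i : ℝ) < μ - D) (fun i _ hi => by linarith)
  have hup := card_numOccupied_ge_le (M := M) (N := N) (by omega) (by omega) (D - 1) (by linarith)
    (fun i => μ + D < (i : ℝ)) (fun i hi => by linarith)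
  have hbad : (Finset.univ.filter fun m : Config M N => ¬ WithinBounds (1 / 2) 13 ε h U m) ⊆
      (Finset.univ.filter fun m : Config M N => ((numOccupied m : ℕ) : ℝ) < μ - D) ∪
      (Finset.univ.filter fun m : Config M N => μ + D < ((numOccupied m : ℕ) : ℝ)) := by
    intro m hm
    have hm := (Finset.mem_filter.mp hm).2
    rw [Finset.mem_union, Finset.mem_filter, Finset.mem_filter]
    by_contra! hcon
    have h1 := hcon.1 (Finset.mem_univ _)
    have h2 := hcon.2 (Finset.mem_univ _)
    refine hm (withinBounds_of_numOccupied ε h (by omega) U m ?_ ?_)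
    · refine le_trans (le_of_eq ?_) h1
      rw [hD, hμ]; ring
    · rw [rate]
      rcases le_total ((1 + ρ) / (1 + δ)) 1 with hr | hr
      · rw [max_eq_left hr, div_one]
        exact_mod_cast numOccupied_le m
      · rw [max_eq_right hr]
        refine h2.trans (le_of_eq ?_)
        rw [hD, hμ]; field_simp
  have hK : (0 : ℝ) ≤ Fintype.card (Config M N) := Nat.cast_nonneg _
  have he1 : Real.exp (-2 * D ^ 2 / N) ≤ (ε / 2) ^ 2 := by
    rw [← hexp]
    apply Real.exp_le_exp.mpr
    have : -2 * D ^ 2 / N = -2 * (D ^ 2 / N) := by ring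
    rw [this]; linarith
  have he2 : Real.exp (-2 * (D - 1) ^ 2 / N) ≤ (ε / 2) ^ 2 := by
    rw [← hexp]
    apply Real.exp_le_exp.mpr
    have : -2 * (D - 1) ^ 2 / N ≤ -(D ^ 2 / N) := by
      rw [← neg_div]
      gcongr
      nlinarith
    linarith
  calc ((Finset.univ.filter fun m : Config M N => ¬ WithinBounds (1 / 2) 13 ε h U m).card : ℝ)
      ≤ ((Finset.univ.filter fun m : Config M N => ((numOccupied m : ℕ) : ℝ) < μ - D).card : ℝ) +
        ((Finset.univ.filter fun m : Config M N => μ + D < ((numOccupied m : ℕ) : ℝ)).card : ℝ) := by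
        exact_mod_cast (Finset.card_le_card hbad).trans (Finset.card_union_le _ _)
    _ ≤ Fintype.card (Config M N) * (ε / 2) ^ 2 + Fintype.card (Config M N) * (ε / 2) ^ 2 :=
        add_le_add (hlow.trans (mul_le_mul_of_nonneg_left he1 hK))
          (hup.trans (mul_le_mul_of_nonneg_left he2 hK))
    _ ≤ Fintype.card (Config M N) * ε ^ 2 := by
        nlinarith [mul_nonneg hK (sq_nonneg ε)]

end Bounds

/-! ### The output probabilities add up to one -/

section Unitarity

variable {M N : ℕ}

/-- Permanental Cauchy–Binet formula for a matrix with orthonormal rows. -/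
theorem sum_factorial_mul_norm_amplitude_sq (A : Matrix (Fin N) (Fin M) ℂ)
    (hA : ∀ k k', ∑ l, A k l * starRingEnd ℂ (A k' l) = if k = k' then 1 else 0) :
    ∑ m : Config M N, (∏ l, ((m.1 l)! : ℝ)) * ‖amplitude A m‖ ^ 2 = 1 := by
  have h1 : ∀ m : Config M N, (∏ l, ((m.1 l)! : ℂ)) * (amplitude A m *
      starRingEnd ℂ (amplitude A m)) = ∑ f with configOf f = m, ∑ σ : Equiv.Perm (Fin N),
        (∏ k, A k (f (σ k))) * starRingEnd ℂ (∏ k, A k (f k)) := by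
    intro m
    rw [← mul_assoc, amplitude, map_sum, Finset.mul_sum]
    refine Finset.sum_congr rfl fun f hf => ?_
    have hf := (Finset.mem_filter.mp hf).2
    rw [← Finset.sum_mul]
    have h2 := sum_perm_comp f fun f => ∏ k, A k (f k)
    rw [hf] at h2
    rw [← h2]
    rfl
  have h3 : ∑ m : Config M N, (∏ l, ((m.1 l)! : ℂ)) * (amplitude A m *
      starRingEnd ℂ (amplitude A m)) = 1 := by
    simp only [h1]
    rw [Finset.sum_fiberwise Finset.univ configOf (fun f => ∑ σ : Equiv.Perm (Fin N),
      (∏ k, A k (f (σ k))) * starRingEnd ℂ (∏ k, A k (f k))), Finset.sum_comm]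
    have h4 : ∀ σ : Equiv.Perm (Fin N), ∑ f : Fin N → Fin M,
        (∏ k, A k (f (σ k))) * starRingEnd ℂ (∏ k, A k (f k)) = if σ = 1 then 1 else 0 := by
      intro σ
      have h5 : ∀ f : Fin N → Fin M, (∏ k, A k (f (σ k))) * starRingEnd ℂ (∏ k, A k (f k)) =
          ∏ k, (A (σ⁻¹ k) (f k) * starRingEnd ℂ (A k (f k))) := by
        intro f
        rw [Finset.prod_mul_distrib, map_prod, ← Equiv.prod_comp σ fun k => A (σ⁻¹ k) (f k)]
        simp
      simp only [h5]
      have h6 := Finset.prod_univ_sum (fun _ : Fin N => (Finset.univ : Finset (Fin M)))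
        fun k l => A (σ⁻¹ k) l * starRingEnd ℂ (A k l)
      rw [Fintype.piFinset_univ] at h6
      rw [← h6]
      simp only [hA]
      split_ifs with hσ
      · simp [hσ]
      · rw [Finset.prod_eq_zero_iff]
        obtain ⟨k, hk⟩ : ∃ k, σ⁻¹ k ≠ k := by
          by_contra! hcon
          exact hσ (inv_eq_one.mp (Equiv.ext hcon))
        exact ⟨k, Finset.mem_univ _, if_neg hk⟩
    rw [Finset.sum_congr rfl fun σ _ => h4 σ]
    simp
  have h6 : ((∑ m : Config M N, (∏ l, ((m.1 l)! : ℝ)) * ‖amplitude A m‖ ^ 2 : ℝ) : ℂ) = 1 := by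
    rw [← h3]
    push_cast
    simp only [Complex.mul_conj']
  exact_mod_cast h6

theorem sum_outputProb (h : N ≤ M) (U : Matrix.unitaryGroup (Fin M) ℂ) :
    ∑ m : Config M N, outputProb h U m = 1 := by
  simp only [outputProb_eq]
  refine sum_factorial_mul_norm_amplitude_sq _ fun k k' => ?_
  have h1 := congrFun (congrFun (Matrix.mem_unitaryGroup_iff.mp U.2) (Fin.castLE h k))
    (Fin.castLE h k')
  rw [Matrix.mul_apply, Matrix.one_apply] at h1
  simpa [inputRows, Matrix.star_apply, Fin.ext_iff] using h1

theorem outputProb_nonneg (h : N ≤ M) (U : Matrix.unitaryGroup (Fin M) ℂ) (m : Config M N) :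
    0 ≤ outputProb h U m := by
  rw [outputProb_eq]
  positivity

end Unitarity

/-! ### The average over the unitary group -/

section Haar

open MeasureTheory

variable {M N : ℕ}

instance (M : ℕ) : (haarUnitary M).IsHaarMeasure := by
  unfold haarUnitary; infer_instance

/-- A compact group is unimodular. -/
instance (M : ℕ) : (haarUnitary M).IsMulRightInvariant :=
  ⟨fun g => by
    have : IsProbabilityMeasure (Measure.map (· * g) (haarUnitary M)) :=
      Measure.isProbabilityMeasure_map (by fun_prop)
    exact Measure.isHaarMeasure_eq_of_isProbabilityMeasure _ _⟩

theorem continuous_amplitude (h : N ≤ M) (m : Config M N) :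
    Continuous fun U : Matrix.unitaryGroup (Fin M) ℂ => amplitude (inputRows h U) m := by
  unfold amplitude inputRows
  refine continuous_finsetSum _ fun f _ => continuous_finsetProd _ fun k _ => ?_
  exact (continuous_apply_apply (Fin.castLE h k) (f k)).comp continuous_subtype_val

theorem continuous_outputProb (h : N ≤ M) (m : Config M N) :
    Continuous fun U : Matrix.unitaryGroup (Fin M) ℂ => outputProb h U m := by
  simp only [outputProb_eq]
  exact continuous_const.mul ((continuous_amplitude h m).norm.pow 2)

theorem integrable_of_continuous {E : Type*} [NormedAddCommGroup E]
    {f : Matrix.unitaryGroup (Fin M) ℂ → E}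
    (hf : Continuous f) : Integrable f (haarUnitary M) :=
  hf.integrable_of_hasCompactSupport (HasCompactSupport.of_compactSpace f)

/-- The unitary matrix that multiplies the amplitude of one port by the phase `z`. -/
noncomputable def phaseShift (i : Fin M) (z : ℂ) (hz : ‖z‖ = 1) : Matrix.unitaryGroup (Fin M) ℂ :=
  ⟨Matrix.diagonal (Function.update 1 i z), by
    rw [Matrix.mem_unitaryGroup_iff, Matrix.star_eq_conjTranspose, Matrix.diagonal_conjTranspose,
      Matrix.diagonal_mul_diagonal, ← Matrix.diagonal_one]
    congr 1
    funext l
    by_cases hl : l = i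
    · subst hl
      simp [Complex.mul_conj', hz]
    · simp [Function.update_of_ne hl]⟩

theorem amplitude_mul_phaseShift (h : N ≤ M) (U : Matrix.unitaryGroup (Fin M) ℂ) (i : Fin M)
    (z : ℂ) (hz : ‖z‖ = 1) (m : Config M N) :
    amplitude (inputRows h (U * phaseShift i z hz)) m = z ^ m.1 i * amplitude (inputRows h U) m := by
  rw [amplitude, amplitude, Finset.mul_sum]
  refine Finset.sum_congr rfl fun f hf => ?_
  have hf := (Finset.mem_filter.mp hf).2
  have h1 : ∀ k l, inputRows h (U * phaseShift i z hz) k l =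
      inputRows h U k l * Function.update (1 : Fin M → ℂ) i z l := by
    intro k l
    simp [inputRows, phaseShift, Matrix.mul_diagonal]
  simp only [h1]
  rw [Finset.prod_mul_distrib, prod_comp_eq_prod_pow_configOf f, hf, mul_comm]
  congr 1
  rw [Finset.prod_eq_single i]
  · simp
  · intro l _ hl
    simp [Function.update_of_ne hl]
  · simp

/-- Amplitudes of different configurations are uncorrelated, as a phase shifter in a port where
the occupations differ shows. -/
theorem integral_amplitude_mul_conj (h : N ≤ M) (m m' : Config M N) (hne : m ≠ m') :
    ∫ U, amplitude (inputRows h U) m * starRingEnd ℂ (amplitude (inputRows h U) m')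
      ∂(haarUnitary M) = 0 := by
  obtain ⟨i, hi⟩ : ∃ i, m.1 i ≠ m'.1 i := by
    by_contra! hcon
    exact hne (Subtype.ext (funext hcon))
  have hle : ∀ c : Config M N, c.1 i < N + 1 := fun c => by
    have h1 : c.1 i ≤ ∑ l, c.1 l :=
      Finset.single_le_sum (fun _ _ => Nat.zero_le _) (Finset.mem_univ i)
    have h2 : ∑ l, c.1 l = N := c.2
    omega
  have hζ := Complex.isPrimitiveRoot_exp (N + 1) (by omega)
  set z := Complex.exp (2 * Real.pi * Complex.I / (N + 1 : ℕ))
  have hz : ‖z‖ = 1 := Complex.norm_eq_one_of_pow_eq_one hζ.pow_eq_one (by omega)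
  have hinv := integral_mul_right_eq_self (μ := haarUnitary M) (fun U =>
    amplitude (inputRows h U) m * starRingEnd ℂ (amplitude (inputRows h U) m')) (phaseShift i z hz)
  simp only [amplitude_mul_phaseShift] at hinv
  have h1 : ∀ U : Matrix.unitaryGroup (Fin M) ℂ, z ^ m.1 i * amplitude (inputRows h U) m *
      starRingEnd ℂ (z ^ m'.1 i * amplitude (inputRows h U) m') =
      (z ^ m.1 i * starRingEnd ℂ (z ^ m'.1 i)) * (amplitude (inputRows h U) m *
        starRingEnd ℂ (amplitude (inputRows h U) m')) := fun U => by
    rw [map_mul]; ring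
  simp only [h1] at hinv
  rw [integral_const_mul] at hinv
  by_contra h0
  have h2 : z ^ m.1 i * starRingEnd ℂ (z ^ m'.1 i) = 1 :=
    mul_right_cancel₀ h0 (by rw [hinv, one_mul])
  have h3 : starRingEnd ℂ (z ^ m'.1 i) * z ^ m'.1 i = 1 := by
    rw [Complex.conj_mul', norm_pow, hz]; simp
  have h4 : z ^ m.1 i = z ^ m'.1 i := by
    calc z ^ m.1 i = z ^ m.1 i * (starRingEnd ℂ (z ^ m'.1 i) * z ^ m'.1 i) := by rw [h3, mul_one]
      _ = z ^ m'.1 i := by rw [← mul_assoc, h2, one_mul]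
  exact hi (hζ.pow_inj (hle m) (hle m') h4)

/-- The mean square of the amplitude of a configuration. -/
noncomputable def meanSqAmplitude (h : N ≤ M) (m : Config M N) : ℝ :=
  ∫ U, ‖amplitude (inputRows h U) m‖ ^ 2 ∂(haarUnitary M)

theorem integral_norm_prod_sq (h : N ≤ M) (z : Fin M → ℝ) :
    ∫ U, ‖∏ k, ∑ l, inputRows h U k l * (z l : ℂ)‖ ^ 2 ∂(haarUnitary M) =
      ∑ m : Config M N, meanSqAmplitude h m * ∏ l, (z l ^ 2) ^ m.1 l := by
  let a := fun (m : Config M N) (U : Matrix.unitaryGroup (Fin M) ℂ) => amplitude (inputRows h U) m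
  let w := fun m : Config M N => ((∏ l, z l ^ m.1 l : ℝ) : ℂ)
  have hcont : ∀ m m', Continuous fun U => w m * w m' * (a m U * starRingEnd ℂ (a m' U)) :=
    fun m m' => continuous_const.mul
      ((continuous_amplitude h m).mul (Complex.continuous_conj.comp (continuous_amplitude h m')))
  have h1 : ∀ U : Matrix.unitaryGroup (Fin M) ℂ,
      ((‖∏ k, ∑ l, inputRows h U k l * (z l : ℂ)‖ ^ 2 : ℝ) : ℂ) =
      ∑ m, ∑ m', w m * w m' * (a m U * starRingEnd ℂ (a m' U)) := by
    intro U
    push_cast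
    rw [← Complex.mul_conj', prod_sum_eq_sum_amplitude, map_sum, Finset.sum_mul_sum]
    refine Finset.sum_congr rfl fun m _ => Finset.sum_congr rfl fun m' _ => ?_
    have h2 : ∀ m : Config M N, ∏ l, (z l : ℂ) ^ m.1 l = w m := fun m => by simp [w]
    rw [h2, h2, map_mul, Complex.conj_ofReal]
    ring
  have h3 : ((∫ U, ‖∏ k, ∑ l, inputRows h U k l * (z l : ℂ)‖ ^ 2 ∂(haarUnitary M) : ℝ) : ℂ) =
      ((∑ m : Config M N, meanSqAmplitude h m * ∏ l, (z l ^ 2) ^ m.1 l : ℝ) : ℂ) := by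
    rw [← integral_complex_ofReal]
    simp only [h1]
    rw [integral_finsetSum _ fun m _ => integrable_of_continuous
      (continuous_finsetSum _ fun m' _ => hcont m m')]
    push_cast
    refine Finset.sum_congr rfl fun m _ => ?_
    rw [integral_finsetSum _ fun m' _ => integrable_of_continuous
      (hcont m m'), Finset.sum_eq_single m]
    · rw [integral_const_mul]
      have h4 : ∫ U, a m U * starRingEnd ℂ (a m U) ∂(haarUnitary M) = meanSqAmplitude h m := by
        rw [meanSqAmplitude, ← integral_complex_ofReal]
        refine integral_congr_ae (Filter.Eventually.of_forall fun U => ?_)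
        simp only [Complex.mul_conj', a]
        push_cast
        rfl
      rw [h4, mul_comm]
      congr 1
      simp only [w]
      push_cast
      rw [← Finset.prod_mul_distrib]
      exact Finset.prod_congr rfl fun l _ => by ring
    · intro m' _ hm'
      rw [integral_const_mul, integral_amplitude_mul_conj h m m' hm'.symm, mul_zero]
    · simp
  exact_mod_cast h3

/-- Every vector is the image of a multiple of a basis vector under a unitary matrix. -/
theorem exists_unitary_column (i : Fin M) (z : Fin M → ℝ) :
    ∃ V : Matrix.unitaryGroup (Fin M) ℂ, ∀ l, (z l : ℂ) = V.1 l i * (√(∑ l, z l ^ 2) : ℝ) := by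
  rcases eq_or_ne (∑ l, z l ^ 2) 0 with h0 | h0
  · refine ⟨1, fun l => ?_⟩
    have := (Finset.sum_eq_zero_iff_of_nonneg fun l _ => sq_nonneg (z l)).mp h0 l (Finset.mem_univ l)
    rw [h0, pow_eq_zero_iff two_ne_zero |>.mp this]
    simp
  · have hpos : 0 < ∑ l, z l ^ 2 :=
      lt_of_le_of_ne (Finset.sum_nonneg fun l _ => sq_nonneg (z l)) h0.symm
    set R := √(∑ l, z l ^ 2) with hR
    have hR0 : 0 < R := Real.sqrt_pos.mpr hpos
    have hR2 : R ^ 2 = ∑ l, z l ^ 2 := Real.sq_sqrt hpos.le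
    let u : EuclideanSpace ℂ (Fin M) := WithLp.toLp 2 fun l => ((z l / R : ℝ) : ℂ)
    have hu : ‖u‖ = 1 := by
      rw [EuclideanSpace.norm_eq, Real.sqrt_eq_one]
      simp only [u, Complex.norm_real, Real.norm_eq_abs, sq_abs, div_pow]
      rw [← Finset.sum_div, hR2, div_self h0]
    have hv : Orthonormal ℂ (Set.domRestrict ({i} : Set (Fin M)) fun _ => u) := by
      rw [orthonormal_iff_ite]
      rintro ⟨a, ha⟩ ⟨b, hb⟩
      obtain rfl := Set.mem_singleton_iff.mp ha
      obtain rfl := Set.mem_singleton_iff.mp hb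
      simp [Set.domRestrict, hu]
    obtain ⟨b, hb⟩ := hv.exists_orthonormalBasis_extension_of_card_eq (by simp)
    refine ⟨⟨_, (EuclideanSpace.basisFun (Fin M) ℂ).toMatrix_orthonormalBasis_mem_unitary b⟩,
      fun l => ?_⟩
    have h1 : (EuclideanSpace.basisFun (Fin M) ℂ).toBasis.toMatrix b l i = ((z l / R : ℝ) : ℂ) := by
      rw [Module.Basis.toMatrix_apply, hb i (Set.mem_singleton i)]
      simp [u]
    change (z l : ℂ) = (EuclideanSpace.basisFun (Fin M) ℂ).toBasis.toMatrix b l i * (R : ℂ)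
    rw [h1, ← Complex.ofReal_mul, div_mul_cancel₀ _ hR0.ne']

/-- Rotating the outputs shows that the mean square of a product of linear forms in the rows of
the multiport depends on the common coefficient vector only through its length. -/
theorem exists_integral_norm_prod_sq (h : N ≤ M) (i : Fin M) : ∃ c : ℝ, ∀ z : Fin M → ℝ,
    ∫ U, ‖∏ k, ∑ l, inputRows h U k l * (z l : ℂ)‖ ^ 2 ∂(haarUnitary M) =
      c * (∑ l, z l ^ 2) ^ N := by
  refine ⟨∫ U, ‖∏ k, inputRows h U k i‖ ^ 2 ∂(haarUnitary M), fun z => ?_⟩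
  obtain ⟨V, hV⟩ := exists_unitary_column i z
  have h1 : ∀ U : Matrix.unitaryGroup (Fin M) ℂ,
      ‖∏ k, ∑ l, inputRows h U k l * (z l : ℂ)‖ ^ 2 =
      ‖∏ k, inputRows h (U * V) k i‖ ^ 2 * (∑ l, z l ^ 2) ^ N := by
    intro U
    have h2 : ∀ k, ∑ l, inputRows h U k l * (z l : ℂ) =
        inputRows h (U * V) k i * (√(∑ l, z l ^ 2) : ℝ) := by
      intro k
      simp only [inputRows, Matrix.of_apply, Submonoid.coe_mul, Matrix.mul_apply, Finset.sum_mul]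
      exact Finset.sum_congr rfl fun l _ => by rw [hV l]; ring
    simp only [h2]
    rw [Finset.prod_mul_distrib, norm_mul, mul_pow, Finset.prod_const, Finset.card_univ,
      Fintype.card_fin, norm_pow, Complex.norm_real, Real.norm_of_nonneg (Real.sqrt_nonneg _),
      ← pow_mul, mul_comm N 2, pow_mul,
      Real.sq_sqrt (Finset.sum_nonneg fun l _ => sq_nonneg (z l))]
  simp only [h1]
  rw [integral_mul_const, integral_mul_right_eq_self (μ := haarUnitary M)
    (fun U => ‖∏ k, inputRows h U k i‖ ^ 2)]

/-- The multinomial theorem, with the coefficients as numbers of assignments. -/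
theorem sum_pow_eq_sum_card (t : Fin M → ℝ) :
    (∑ l, t l) ^ N = ∑ m : Config M N,
      ((Finset.univ.filter fun f : Fin N → Fin M => configOf f = m).card : ℝ) *
        ∏ l, t l ^ m.1 l := by
  have h1 := prod_sum_eq_sum_amplitude (N := N) (fun _ _ => 1) (fun l : Fin M => (t l : ℂ))
  simp only [amplitude, one_mul, Finset.prod_const_one, Finset.sum_const, Finset.prod_const,
    Finset.card_univ, Fintype.card_fin, nsmul_eq_mul, mul_one] at h1
  exact_mod_cast h1

theorem coeff_eq_of_sum_eq (b c : Config M N → ℝ)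
    (h : ∀ z : Fin M → ℝ, ∑ m : Config M N, b m * ∏ l, (z l ^ 2) ^ m.1 l =
      ∑ m : Config M N, c m * ∏ l, (z l ^ 2) ^ m.1 l) : b = c := by
  let P := fun b : Config M N → ℝ => ∑ m : Config M N,
    MvPolynomial.monomial (Finsupp.equivFunOnFinite.symm m.1) (b m)
  have heval : ∀ b t, MvPolynomial.eval t (P b) = ∑ m : Config M N, b m * ∏ l, t l ^ m.1 l := by
    intro b t
    simp [P, MvPolynomial.eval_monomial, Finsupp.prod_fintype]
  have hcoeff : ∀ b m, (P b).coeff (Finsupp.equivFunOnFinite.symm m.1) = b m := by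
    intro b m
    rw [MvPolynomial.coeff_sum, Finset.sum_eq_single m]
    · simp
    · intro m' _ hne
      rw [MvPolynomial.coeff_monomial, if_neg]
      intro heq
      exact hne (Subtype.ext (Finsupp.equivFunOnFinite.symm.injective heq))
    · simp
  have hP : P b = P c := by
    refine MvPolynomial.funext_set (fun _ => Set.Ici (0 : ℝ)) (fun _ => Set.Ici_infinite 0) ?_
    intro t ht
    have ht : ∀ l, √(t l) ^ 2 = t l := fun l => Real.sq_sqrt (ht l (Set.mem_univ l))
    have := h fun l => √(t l)
    simp only [ht] at this
    rw [heval, heval, this]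
  funext m
  rw [← hcoeff b m, hP, hcoeff]

/-- Averaged over the multiports, all output configurations are equally probable. -/
theorem integral_outputProb (h : N ≤ M) (hN : 0 < N) (m : Config M N) :
    ∫ U, outputProb h U m ∂(haarUnitary M) = 1 / Fintype.card (Config M N) := by
  obtain ⟨c, hc⟩ := exists_integral_norm_prod_sq h ⟨0, by omega⟩
  have hcoeff := coeff_eq_of_sum_eq (meanSqAmplitude h) (fun m =>
      c * (Finset.univ.filter fun f : Fin N → Fin M => configOf f = m).card) fun z => by
    rw [← integral_norm_prod_sq, hc z, sum_pow_eq_sum_card, Finset.mul_sum]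
    exact Finset.sum_congr rfl fun m _ => by ring
  have hconst : ∀ m : Config M N, ∫ U, outputProb h U m ∂(haarUnitary M) = c * (N ! : ℝ) := by
    intro m
    simp only [outputProb_eq]
    rw [integral_const_mul]
    change _ * meanSqAmplitude h m = _
    rw [hcoeff, ← card_assignments_mul m]
    push_cast
    ring
  have hsum : ∑ m : Config M N, ∫ U, outputProb h U m ∂(haarUnitary M) = 1 := by
    rw [← integral_finsetSum _ fun m _ => integrable_of_continuous (continuous_outputProb h m)]
    simp [sum_outputProb]
  simp only [hconst, Finset.sum_const, Finset.card_univ, nsmul_eq_mul] at hsum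
  rw [hconst]
  exact eq_one_div_of_mul_eq_one_right hsum

end Haar

/-! ### The probability of the bounds -/

section Typical

open MeasureTheory

variable {M N : ℕ}

theorem continuous_probWithinBounds (c C ε : ℝ) (h : N ≤ M) :
    Continuous fun U : Matrix.unitaryGroup (Fin M) ℂ => probWithinBounds c C ε h U := by
  unfold probWithinBounds
  refine continuous_finsetSum _ fun m _ => ?_
  by_cases hm : WithinBounds c C ε h 1 m
  · have h1 : ∀ U, WithinBounds c C ε h U m := fun U => (withinBounds_congr c C ε h U 1 m).mpr hm
    simpa only [h1, if_true] using continuous_outputProb h m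
  · have h1 : ∀ U, ¬ WithinBounds c C ε h U m :=
      fun U hU => hm ((withinBounds_congr c C ε h U 1 m).mp hU)
    simpa only [h1, if_false] using continuous_const

theorem probWithinBounds_nonneg (c C ε : ℝ) (h : N ≤ M) (U : Matrix.unitaryGroup (Fin M) ℂ) :
    0 ≤ probWithinBounds c C ε h U := by
  refine Finset.sum_nonneg fun m _ => ?_
  split_ifs
  · exact outputProb_nonneg h U m
  · exact le_rfl

open Classical in
theorem one_sub_probWithinBounds (c C ε : ℝ) (h : N ≤ M) (U : Matrix.unitaryGroup (Fin M) ℂ) :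
    1 - probWithinBounds c C ε h U =
      ∑ m with ¬ WithinBounds c C ε h 1 m, outputProb h U m := by
  rw [← sum_outputProb h U, probWithinBounds, Finset.sum_filter, ← Finset.sum_sub_distrib]
  refine Finset.sum_congr rfl fun m _ => ?_
  rw [withinBounds_congr c C ε h U 1 m]
  split_ifs <;> simp_all

/-- On average over the multiports, the bounds fail with probability at most `ε ^ 2`. The square
leaves room for Markov's inequality. -/
theorem integral_one_sub_probWithinBounds_le (ε : ℝ) (hε : 0 < ε) (hε1 : ε < 1) (h : N ≤ M)
    (hN : 16 ≤ N) :
    ∫ U, (1 - probWithinBounds (1 / 2) 13 ε h U) ∂(haarUnitary M) ≤ ε ^ 2 := by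
  classical
  simp only [one_sub_probWithinBounds]
  rw [integral_finsetSum _ fun m _ => integrable_of_continuous (continuous_outputProb h m)]
  simp only [integral_outputProb h (by omega : 0 < N), Finset.sum_const, nsmul_eq_mul]
  have h1 := card_not_withinBounds_le ε hε hε1 h hN 1
  have h2 : (0 : ℝ) < Fintype.card (Config M N) := by
    rw [card_config (by omega)]
    exact_mod_cast Nat.choose_pos (by omega)
  rw [mul_one_div, div_le_iff₀ h2, mul_comm]
  convert h1

end Typical

theorem theorem1 :
    (∀ (M N : ℕ) (h : N ≤ M) (U : Matrix.unitaryGroup (Fin M) ℂ) (m : Config M N),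
      (glynnProb h U m).val = (outputProb h U m : ℂ)) ∧
    ∃ c C : ℝ, 0 < c ∧ 0 < C ∧ ∀ ε : ℝ, 0 < ε → ∃ N₀ : ℕ, ∀ (M N : ℕ) (h : N ≤ M), N₀ ≤ N →
      1 - ε ≤ ∫ U, probWithinBounds c C ε h U ∂(haarUnitary M) ∧
      1 - ε ≤ (haarUnitary M).real {U | 1 - ε ≤ probWithinBounds c C ε h U} := by
  refine ⟨fun M N h U m => ?_, 1 / 2, 13, by norm_num, by norm_num, fun ε hε =>
    ⟨16, fun M N h hN => ?_⟩⟩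
  · rw [outputProb_eq]
    exact val_modifiedGlynn _ m
  rcases le_or_gt 1 ε with hε1 | hε1
  · exact ⟨(sub_nonpos.mpr hε1).trans
      (MeasureTheory.integral_nonneg fun U => probWithinBounds_nonneg _ _ _ h U),
      (sub_nonpos.mpr hε1).trans MeasureTheory.measureReal_nonneg⟩
  have hcont := continuous_probWithinBounds (1 / 2) 13 ε h
  have hfail := integral_one_sub_probWithinBounds_le ε hε hε1 h hN
  constructor
  · rw [MeasureTheory.integral_sub (MeasureTheory.integrable_const _)
      (integrable_of_continuous hcont)] at hfail
    simp only [MeasureTheory.integral_const, MeasureTheory.probReal_univ, smul_eq_mul,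
      mul_one] at hfail
    nlinarith
  · have hmarkov := MeasureTheory.mul_meas_ge_le_integral_of_nonneg (μ := haarUnitary M)
      (f := fun U => 1 - probWithinBounds (1 / 2) 13 ε h U)
      (Filter.Eventually.of_forall fun U => by
        classical
        change 0 ≤ 1 - probWithinBounds (1 / 2) 13 ε h U
        rw [one_sub_probWithinBounds]
        exact Finset.sum_nonneg fun m _ => outputProb_nonneg h U m)
      (integrable_of_continuous (continuous_const.sub hcont)) ε
    have hle : (haarUnitary M).real {U | ε ≤ 1 - probWithinBounds (1 / 2) 13 ε h U} ≤ ε :=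
      le_of_mul_le_mul_left (by nlinarith) hε
    have hmeas : MeasurableSet {U | ε ≤ 1 - probWithinBounds (1 / 2) 13 ε h U} :=
      (isClosed_le continuous_const (continuous_const.sub hcont)).measurableSet
    have hcompl := MeasureTheory.probReal_compl_eq_one_sub (μ := haarUnitary M) hmeas
    have hmono : (haarUnitary M).real {U | ε ≤ 1 - probWithinBounds (1 / 2) 13 ε h U}ᶜ ≤
        (haarUnitary M).real {U | 1 - ε ≤ probWithinBounds (1 / 2) 13 ε h U} := by
      refine MeasureTheory.measureReal_mono fun U hU => ?_
      simp only [Set.mem_compl_iff, Set.mem_ofPred_eq, not_le] at hU ⊢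
      linarith
    linarith
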